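/- Let $m,p\ge 1$, $n=m+p$, and let $\Lambda=\mathrm{diag}(\lambda_1,\dots,\lambda_n)\in C^1([0,+\infty)\times[0,1])^{n\times n}$ with $\Lambda,\partial_x\Lambda$ bounded. Assume that for some $\epsilon>0$ and all $t\ge 0$, $x\in[0,1]$, $$\lambda_1<\dots<\lambda_m<-\epsilon<0<\epsilon<\lambda_{m+1}<\dots<\lambda_n,\qquad \lambda_{i+1}-\lambda_i>\epsilon\quad(1\le i\le n-1).$$ Write $y=(y_-,y_+)\in\mathbb R^m\times\mathbb R^p$. For bounded continuous $M,G:[0,+\infty)\times[0,1]\to\mathbb R^{n\times n}$ and $Q:[0,+\infty)\to\mathbb R^{p\times m}$, and for $F\in L^\infty((0,+\infty)\times(0,1))^{m\times n}$, let $(M,G,F,Q)$ denote the system $$\begin{cases}\partial_t y(t,x)+\Lambda(t,x)\partial_x y(t,x)=M(t,x)y(t,x)+G(t,x)y(t,0),\\ y_-(t,1)=\int_0^1F(t,\xi)y(t,\xi)\,d\xi,\qquad y_+(t,0)=Q(t)y_-(t,0),\\ y(t^0,x)=y^0(x),\end{cases}\qquad t>t^0\ge 0,\ x\in(0,1).$$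 For $t^0\ge0$ and $y^0\in L^2(0,1)^n$, its broad solution is the function $y\in C^0([t^0,t^0+T'];L^2(0,1)^n)\cap C^0([0,1];L^2(t^0,t^0+T')^n)$ (for all $T'>0$) that satisfies, for a.e. $(t,x)\in(t^0,+\infty)\times(0,1)$ and all $i$, the equation integrated along the characteristic $\chi_i$ (where $\partial_s\chi_i(s)=\lambda_i(s,\chi_i(s))$, $\chi_i(t)=x$) from its entry into $[t^0,+\infty)\times[0,1]$ up to time $t$, starting from the value that the boundary or initial condition prescribes at the entry point. For $T>0$, the system $(M,G,F,Q)$ is called finite-time stable with settling time $T$ if its broad solutions satisfy (i) $y(t^0+T,\cdot)=0$ for every $t^0\ge0$ and $y^0\in L^2(0,1)^n$; (ii) for every $\varepsilon>0$ there is $\delta>0$ such that, for every $t^0\ge 0$ and $y^0\in L^2(0,1)^n$, $\|y^0\|_{L^2}\le\delta$ implies $\|y(t,\cdot)\|_{L^2}\le\varepsilon$ for all $t\ge t^0$. Let $Q^1:[0,+\infty)\to\mathbb R^{p\times m}$, $G^2_{--}:[0,+\infty)\times[0,1]\to\mathbb R^{m\times m}$ and $G^2_{+-}:[0,+\infty)\times[0,1]\to\mathbb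 R^{p\times m}$ be bounded and continuous, with $G^2_{--}$ strictly lower triangular, and set $$G^2=\begin{pmatrix}G^2_{--}&0\\ G^2_{+-}&0\end{pmatrix},\qquad G^3=\begin{pmatrix}0&0\\ G^2_{+-}&0\end{pmatrix}.$$ **Proposition.** There exists $F^2\in L^\infty((0,+\infty)\times(0,1))^{m\times n}$ such that, for every $T>0$, if $(0,G^3,0,Q^1)$ is finite-time stable with settling time $T$, then $(0,G^2,F^2,Q^1)$ is finite-time stable with settling time $T$. -/

import Mathlib

open Set MeasureTheory Filter Topology
open scoped ENNReal

/-- The state space `ℝⁿ = ℝᵐ × ℝᵖ`, with the Euclidean norm. The coordinates `Sum.inl i` form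
`y₋` (negative speeds), the coordinates `Sum.inr k` form `y₊` (positive speeds). -/
abbrev HypState (m p : ℕ) : Type := EuclideanSpace ℝ (Fin m ⊕ Fin p)

/-- The closed space-time domain `[0,+∞) × [0,1]`. -/
def closedStrip : Set (ℝ × ℝ) := Ici (0 : ℝ) ×ˢ Icc (0 : ℝ) 1

/-- `C⁰([0,+∞) × [0,1]) ∩ L^∞((0,+∞) × (0,1))` for matrix-valued functions. -/
def IsBoundedContinuousMatrix {ι κ : Type} (A : ℝ → ℝ → Matrix ι κ ℝ) : Prop :=
  ∀ i j, ContinuousOn (fun q : ℝ × ℝ => A q.1 q.2 i j) closedStrip ∧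
    ∃ C : ℝ, ∀ t x : ℝ, 0 ≤ t → x ∈ Icc (0 : ℝ) 1 → |A t x i j| ≤ C

/-- `C⁰([0,+∞)) ∩ L^∞(0,+∞)` for matrix-valued functions of time. -/
def IsBoundedContinuousMatrixTime {ι κ : Type} (A : ℝ → Matrix ι κ ℝ) : Prop :=
  ∀ i j, ContinuousOn (fun t : ℝ => A t i j) (Ici 0) ∧
    ∃ C : ℝ, ∀ t : ℝ, 0 ≤ t → |A t i j| ≤ C

/-- `L^∞((0,+∞) × (0,1))` for matrix-valued functions. -/
def IsLInftyMatrix {ι κ : Type} (A : ℝ → ℝ → Matrix ι κ ℝ) : Prop :=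
  ∀ i j, MemLp (fun q : ℝ × ℝ => A q.1 q.2 i j) ∞
    (volume.restrict (Ioi (0 : ℝ) ×ˢ Ioo (0 : ℝ) 1))

/-- The standing assumptions on `Λ = diag(λ₁, …, λₙ)`: every `λᵢ` is `C¹` on `[0,+∞) × [0,1]`,
`Λ` and `∂Λ/∂x` are bounded there, and for some `ε > 0` one has
`λ₁ < ⋯ < λₘ < -ε < 0 < ε < λₘ₊₁ < ⋯ < λₙ` with consecutive gaps larger than `ε`
(the gap between `λₘ` and `λₘ₊₁` is automatic). -/
structure AdmissibleSpeeds {m p : ℕ} (lam : ℝ → ℝ → Fin m ⊕ Fin p → ℝ) : Prop where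
  contDiff : ∀ i, ContDiffOn ℝ 1 (fun q : ℝ × ℝ => lam q.1 q.2 i) closedStrip
  bounded : ∃ R : ℝ, ∀ i, ∀ t x : ℝ, 0 ≤ t → x ∈ Icc (0 : ℝ) 1 →
    |lam t x i| ≤ R ∧ |derivWithin (fun x' => lam t x' i) (Icc 0 1) x| ≤ R
  separated : ∃ ε : ℝ, 0 < ε ∧ ∀ t x : ℝ, 0 ≤ t → x ∈ Icc (0 : ℝ) 1 →
    (∀ i : Fin m, lam t x (Sum.inl i) < -ε) ∧
    (∀ k : Fin p, ε < lam t x (Sum.inr k)) ∧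
    (∀ i j : Fin m, i < j → ε < lam t x (Sum.inl j) - lam t x (Sum.inl i)) ∧
    (∀ k l : Fin p, k < l → ε < lam t x (Sum.inr l) - lam t x (Sum.inr k))

/-- The end of `[0,1]` through which the characteristics of the `i`-th equation enter:
`x = 1` for negative speeds, `x = 0` for positive speeds. -/
def entryPoint {m p : ℕ} : Fin m ⊕ Fin p → ℝ
  | Sum.inl _ => 1
  | Sum.inr _ => 0

/-- `c : [s₀, t] → [0,1]` is the part inside `[t⁰, t] × [0,1]` of the characteristic `χ(·; t, x)` of
the scalar speed `l` that passes through `x` at time `t`. Backwards in time it is followed either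
down to the initial time `t⁰` or up to the time where it entered `[0,1]` at the end point `e`;
so `s₀ = max {t⁰, sⁱⁿ(t, x)}`. -/
structure IsBackwardCharacteristic (l : ℝ → ℝ → ℝ) (e t0 t x s0 : ℝ) (c : ℝ → ℝ) : Prop where
  time_mem : s0 ∈ Icc t0 t
  inside : ∀ s ∈ Icc s0 t, c s ∈ Icc (0 : ℝ) 1
  ode : ∀ s ∈ Icc s0 t, HasDerivWithinAt c (l s (c s)) (Icc s0 t) s
  final : c t = x
  start : s0 = t0 ∨ c s0 = e

/-- `y ∈ C⁰([t⁰, t⁰+T]; L²(0,1)ⁿ) ∩ C⁰([0,1]; L²(t⁰, t⁰+T)ⁿ)` for all `T > 0`, for a jointly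
(almost everywhere) measurable function `y` all of whose sections are the right ones. In particular
`y (·, 0)` is the trace of `y` at `x = 0`. -/
structure HasBroadRegularity {m p : ℕ} (t0 : ℝ) (y : ℝ → ℝ → HypState m p) : Prop where
  measurable : AEStronglyMeasurable (fun q : ℝ × ℝ => y q.1 q.2)
    (volume.restrict (Ioi t0 ×ˢ Ioo (0 : ℝ) 1))
  memLp_space : ∀ t, t0 ≤ t → MemLp (y t) 2 (volume.restrict (Ioo (0 : ℝ) 1))
  continuous_time : ∀ t, t0 ≤ t →
    Tendsto (fun s => eLpNorm (fun x => y s x - y t x) 2 (volume.restrict (Ioo (0 : ℝ) 1)))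
      (𝓝[Ici t0] t) (𝓝 0)
  memLp_time : ∀ T > 0, ∀ x ∈ Icc (0 : ℝ) 1,
    MemLp (fun t => y t x) 2 (volume.restrict (Ioo t0 (t0 + T)))
  continuous_space : ∀ T > 0, ∀ x ∈ Icc (0 : ℝ) 1,
    Tendsto (fun x' => eLpNorm (fun t => y t x' - y t x) 2 (volume.restrict (Ioo t0 (t0 + T))))
      (𝓝[Icc 0 1] x) (𝓝 0)

/-- The boundary values prescribed to the incoming components at time `s`:
`y₋(s,1) = ∫₀¹ F(s,ξ) y(s,ξ) dξ` and `y₊(s,0) = Q(s) y₋(s,0)`. -/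
noncomputable def boundaryValue {m p : ℕ}
    (F : ℝ → ℝ → Matrix (Fin m) (Fin m ⊕ Fin p) ℝ) (Q : ℝ → Matrix (Fin p) (Fin m) ℝ)
    (y : ℝ → ℝ → HypState m p) (s : ℝ) : Fin m ⊕ Fin p → ℝ
  | Sum.inl i => ∑ j, ∫ ξ in (0 : ℝ)..1, F s ξ i j * y s ξ j
  | Sum.inr k => ∑ j : Fin m, Q s k j * y s 0 (Sum.inl j)

/-- `y` is a broad solution (solution along the characteristics) on `(t⁰,+∞) × (0,1)` of the
system `(M, G, F, Q)`:
`∂ₜy + Λ ∂ₓy = M y + G y(t,0)`, `y₋(t,1) = ∫₀¹ F(t,ξ) y(t,ξ) dξ`, `y₊(t,0) = Q(t) y₋(t,0)`,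
`y(t⁰,·) = y⁰`. The system, integrated along the characteristics from their entry into
`[t⁰,+∞) × [0,1]`, holds almost everywhere. -/
structure IsBroadSolution {m p : ℕ} (lam : ℝ → ℝ → Fin m ⊕ Fin p → ℝ)
    (M G : ℝ → ℝ → Matrix (Fin m ⊕ Fin p) (Fin m ⊕ Fin p) ℝ)
    (F : ℝ → ℝ → Matrix (Fin m) (Fin m ⊕ Fin p) ℝ) (Q : ℝ → Matrix (Fin p) (Fin m) ℝ)
    (t0 : ℝ) (y0 : ℝ → HypState m p) (y : ℝ → ℝ → HypState m p) : Prop where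
  regularity : HasBroadRegularity t0 y
  equation : ∀ᵐ q : ℝ × ℝ ∂(volume.restrict (Ioi t0 ×ˢ Ioo (0 : ℝ) 1)),
    ∀ (i : Fin m ⊕ Fin p) (s0 : ℝ) (c : ℝ → ℝ),
      IsBackwardCharacteristic (fun s z => lam s z i) (entryPoint i) t0 q.1 q.2 s0 c →
      y q.1 q.2 i =
        (if t0 < s0 then boundaryValue F Q y s0 i else y0 (c t0) i)
        + (∑ j, ∫ s in s0..q.1, M s (c s) i j * y s (c s) j)
        + (∑ j, ∫ s in s0..q.1, G s (c s) i j * y s 0 j)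

/-- Finite-time stability with settling time `T` of the system `(M, G, F, Q)`: for all `t⁰ ≥ 0` and
`y⁰ ∈ L²(0,1)ⁿ` the solution vanishes at time `t⁰ + T` (finite-time global attractor), and for every
`ε > 0` there is `δ > 0`, independent of `t⁰` and `y⁰`, such that `‖y⁰‖ ≤ δ` implies
`‖y(t,·)‖ ≤ ε` for all `t ≥ t⁰` (uniform stability). The norms are those of `L²(0,1)ⁿ`. -/
def FiniteTimeStable {m p : ℕ} (lam : ℝ → ℝ → Fin m ⊕ Fin p → ℝ)
    (M G : ℝ → ℝ → Matrix (Fin m ⊕ Fin p) (Fin m ⊕ Fin p) ℝ)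
    (F : ℝ → ℝ → Matrix (Fin m) (Fin m ⊕ Fin p) ℝ) (Q : ℝ → Matrix (Fin p) (Fin m) ℝ)
    (T : ℝ) : Prop :=
  (∀ t0 : ℝ, 0 ≤ t0 → ∀ y0 : ℝ → HypState m p, MemLp y0 2 (volume.restrict (Ioo (0 : ℝ) 1)) →
    ∀ y, IsBroadSolution lam M G F Q t0 y0 y →
      y (t0 + T) =ᵐ[volume.restrict (Ioo (0 : ℝ) 1)] 0) ∧
  (∀ ε : ℝ, 0 < ε → ∃ δ : ℝ, 0 < δ ∧
    ∀ t0 : ℝ, 0 ≤ t0 → ∀ y0 : ℝ → HypState m p, MemLp y0 2 (volume.restrict (Ioo (0 : ℝ) 1)) →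
      eLpNorm y0 2 (volume.restrict (Ioo (0 : ℝ) 1)) ≤ ENNReal.ofReal δ →
      ∀ y, IsBroadSolution lam M G F Q t0 y0 y →
        ∀ t, t0 ≤ t → eLpNorm (y t) 2 (volume.restrict (Ioo (0 : ℝ) 1)) ≤ ENNReal.ofReal ε)

/-! Write `u_j = y_j(·,0)` for the traces of the components with negative speeds and `g = G²₋₋`. Let
`w_i` solve `∂ₜw_i + λ_i ∂ₓw_i = ∑ⱼ g_ij u_j` with `w_i(t,0) = 0`: it is minus the integral of the
source along the characteristic from time `t` until its arrival at `x = 0`, so it involves future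
values of the trace. The function `z = y - (w,0)` has the same trace at `x = 0`, has no source in
its negative rows, and has unchanged positive rows. It therefore solves `(0,G³,0,Q¹)` as soon as the
feedback achieves `y_i(t,1) = w_i(t,1)`.

This condition is a feedback law in `y(t,·)`. Since `z_j` is constant along characteristics, `u_j(r)
= z_j(t,η)` when `r` is the arrival time of the `j`-th characteristic starting from `η` at time `t`.
At later times `u_j(r) = 0`, because `z_j` enters through `x = 1` with the value zero. The
substitution `r ↦ η` gives `w(t,·) = -K z(t,·)` with a bounded, strictly lower triangular integral
kernel (`sourceTerm_eq_kernel`). Hence `y = (I - K) z`, and `K` is nilpotent, so `z = (I + R_m) y`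
with a finite Neumann sum `R_m` (`eq_add_resolvent`), and `w(t,1) = -(R_{m+1} y)(t,1)` with `R_{m+1}
= K + K R_m`. There is no circularity: row `i` of `K` involves only `u_j` with `j < i`, so the
boundary identity and the vanishing of late traces follow together by induction on `i`
(`boundary_eq_sourceTerm`, `ae_zeroTrace_eq_zero`).

The kernels are bounded uniformly in time. This gives `‖z⁰‖ ≤ (1+D)‖y⁰‖` and `‖y(t)‖ ≤ (1+D)‖z(t)‖`
with `D` independent of `t⁰` and `y⁰`, which transfers both the attractor property and the uniform
stability (`exists_transform_bounds`).

The equation of a broad solution holds only for almost every `(t,x)`, whereas the argument uses the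
trace at `x = 0` and the section at every time. `ae_trace_eq` and `ae_section_eq` pass to these null
sets by approximation along characteristics. -/

/-! ### Flow and hitting times of a negative scalar speed -/

open scoped NNReal in
/-- A scalar speed on `ℝ × ℝ`, bounded away from zero by a negative constant, with its flow
`flow s t x` (position at time `s` of the characteristic through `x` at time `t`). -/
structure NegativeFlow where
  speed : ℝ → ℝ → ℝ
  flow : ℝ → ℝ → ℝ → ℝ
  lip : ℝ≥0
  bound : ℝ
  gap : ℝ
  gap_pos : 0 < gap
  continuous_speed : Continuous fun q : ℝ × ℝ => speed q.1 q.2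
  lipschitz_speed : ∀ t, LipschitzWith lip (speed t)
  abs_speed_le : ∀ t x, |speed t x| ≤ bound
  speed_le : ∀ t x, speed t x ≤ -gap
  flow_self : ∀ t x, flow t t x = x
  hasDerivAt_flow : ∀ s t x, HasDerivAt (fun s => flow s t x) (speed s (flow s t x)) s

open scoped NNReal in
theorem exists_solution_Icc {v : ℝ → ℝ → ℝ} {K : ℝ≥0} {R : ℝ}
    (hc : Continuous fun q : ℝ × ℝ => v q.1 q.2) (hl : ∀ t, LipschitzWith K (v t))
    (hb : ∀ t x, |v t x| ≤ R) (t x : ℝ) {a b : ℝ} (ha : a ≤ t) (hb' : t ≤ b) :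
    ∃ c : ℝ → ℝ, c t = x ∧ ∀ s ∈ Icc a b, HasDerivWithinAt c (v s (c s)) (Icc a b) s := by
  have hR : 0 ≤ R := (abs_nonneg _).trans (hb 0 0)
  have hm : 0 ≤ max (b - t) (t - a) := le_max_of_le_left (sub_nonneg.2 hb')
  let t' : Icc a b := ⟨t, ha, hb'⟩
  have h : IsPicardLindelof v t' x (⟨R * max (b - t) (t - a), mul_nonneg hR hm⟩ : ℝ≥0) 0
      (⟨R, hR⟩ : ℝ≥0) K :=
    { lipschitzOnWith := fun s _ => (hl s).lipschitzOnWith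
      continuousOn := fun y _ =>
        (hc.comp (continuous_id.prodMk continuous_const : Continuous fun s : ℝ => (s, y))).continuousOn
      norm_le := fun s _ y _ => hb s y
      mul_max_le := by
        simp only [NNReal.coe_zero, sub_zero]
        exact le_rfl }
  obtain ⟨c, hc0, hc1⟩ := h.exists_eq_forall_mem_Icc_hasDerivWithinAt₀
  exact ⟨c, hc0, hc1⟩

open scoped NNReal in
theorem dist_solution_le_forward {v : ℝ → ℝ → ℝ} {K : ℝ≥0} (hl : ∀ t, LipschitzWith K (v t))
    {c d : ℝ → ℝ} {a b : ℝ}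
    (hc : ∀ s ∈ Icc a b, HasDerivWithinAt c (v s (c s)) (Icc a b) s)
    (hd : ∀ s ∈ Icc a b, HasDerivWithinAt d (v s (d s)) (Icc a b) s) :
    ∀ s ∈ Icc a b, |c s - d s| ≤ |c a - d a| * Real.exp (K * (s - a)) := by
  have key : ∀ {e : ℝ → ℝ}, (∀ s ∈ Icc a b, HasDerivWithinAt e (v s (e s)) (Icc a b) s) →
      ∀ s ∈ Ico a b, HasDerivWithinAt e (v s (e s)) (Ici s) s := by
    intro e he s hs
    have := (he s ⟨hs.1, hs.2.le⟩).mono (Icc_subset_Icc_left hs.1)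
    exact this.mono_of_mem_nhdsWithin (Icc_mem_nhdsGE hs.2)
  intro s hs
  exact dist_le_of_trajectories_ODE hl (fun s hs => (hc s hs).continuousWithinAt) (key hc)
    (fun s hs => (hd s hs).continuousWithinAt) (key hd) le_rfl s hs

open scoped NNReal in
-- The reversal `s ↦ -s` reduces this to the forward Grönwall estimate.
theorem dist_solution_le_backward {v : ℝ → ℝ → ℝ} {K : ℝ≥0} (hl : ∀ t, LipschitzWith K (v t))
    {c d : ℝ → ℝ} {a b : ℝ}
    (hc : ∀ s ∈ Icc a b, HasDerivWithinAt c (v s (c s)) (Icc a b) s)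
    (hd : ∀ s ∈ Icc a b, HasDerivWithinAt d (v s (d s)) (Icc a b) s) :
    ∀ s ∈ Icc a b, |c s - d s| ≤ |c b - d b| * Real.exp (K * (b - s)) := by
  have key : ∀ {e : ℝ → ℝ}, (∀ s ∈ Icc a b, HasDerivWithinAt e (v s (e s)) (Icc a b) s) →
      ∀ s ∈ Icc (-b) (-a), HasDerivWithinAt (fun s => e (-s)) ((fun s x => -v (-s) x) s (e (-s)))
        (Icc (-b) (-a)) s := by
    intro e he s hs
    have h1 := he (-s) ⟨by linarith [hs.2], by linarith [hs.1]⟩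
    have h2 : HasDerivWithinAt (fun s : ℝ => -s) (-1) (Icc (-b) (-a)) s :=
      (hasDerivAt_neg s).hasDerivWithinAt
    have h3 := HasDerivWithinAt.scomp s h1 h2
      (fun r hr => ⟨by linarith [hr.2], by linarith [hr.1]⟩)
    simpa [Function.comp_def] using h3
  intro s hs
  have := dist_solution_le_forward (v := fun s x => -v (-s) x) (K := K) (fun t => (hl (-t)).neg)
    (key hc) (key hd) (-s) ⟨by linarith [hs.2], by linarith [hs.1]⟩
  simp only [neg_neg] at this
  rwa [show -s - -b = b - s by ring] at this

open scoped NNReal in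
theorem solution_eq_of_eq {v : ℝ → ℝ → ℝ} {K : ℝ≥0} (hl : ∀ t, LipschitzWith K (v t))
    {c d : ℝ → ℝ} {a b t : ℝ} (ht : t ∈ Icc a b)
    (hc : ∀ s ∈ Icc a b, HasDerivWithinAt c (v s (c s)) (Icc a b) s)
    (hd : ∀ s ∈ Icc a b, HasDerivWithinAt d (v s (d s)) (Icc a b) s) (h : c t = d t) :
    ∀ s ∈ Icc a b, c s = d s := by
  intro s hs
  have h0 : |c s - d s| ≤ 0 := by
    rcases le_total s t with hst | hst
    · have := dist_solution_le_backward hl (a := a) (b := t)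
        (fun r hr => (hc r ⟨hr.1, hr.2.trans ht.2⟩).mono (Icc_subset_Icc_right ht.2))
        (fun r hr => (hd r ⟨hr.1, hr.2.trans ht.2⟩).mono (Icc_subset_Icc_right ht.2)) s ⟨hs.1, hst⟩
      simpa [h] using this
    · have := dist_solution_le_forward hl (a := t) (b := b)
        (fun r hr => (hc r ⟨ht.1.trans hr.1, hr.2⟩).mono (Icc_subset_Icc_left ht.1))
        (fun r hr => (hd r ⟨ht.1.trans hr.1, hr.2⟩).mono (Icc_subset_Icc_left ht.1)) s ⟨hst, hs.2⟩
      simpa [h] using this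
  linarith [abs_nonpos_iff.1 h0]

open scoped NNReal in
theorem exists_global_solution {v : ℝ → ℝ → ℝ} {K : ℝ≥0} {R : ℝ}
    (hc : Continuous fun q : ℝ × ℝ => v q.1 q.2) (hl : ∀ t, LipschitzWith K (v t))
    (hb : ∀ t x, |v t x| ≤ R) (t x : ℝ) :
    ∃ c : ℝ → ℝ, c t = x ∧ ∀ s, HasDerivAt c (v s (c s)) s := by
  have ex : ∀ r : ℝ, ∃ c : ℝ → ℝ, 0 ≤ r → c t = x ∧ ∀ s ∈ Icc (t - r) (t + r),
      HasDerivWithinAt c (v s (c s)) (Icc (t - r) (t + r)) s := by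
    intro r
    by_cases hr : 0 ≤ r
    · obtain ⟨c, h⟩ := exists_solution_Icc hc hl hb t x (a := t - r) (b := t + r)
        (by linarith) (by linarith)
      exact ⟨c, fun _ => h⟩
    · exact ⟨0, fun h => absurd h hr⟩
  choose e he using ex
  have agree : ∀ r r' : ℝ, 0 ≤ r → r ≤ r' → ∀ s ∈ Icc (t - r) (t + r), e r s = e r' s := by
    intro r r' hr hrr'
    have hsub : Icc (t - r) (t + r) ⊆ Icc (t - r') (t + r') :=
      Icc_subset_Icc (by linarith) (by linarith)
    refine solution_eq_of_eq hl (t := t) ⟨by linarith, by linarith⟩ (he r hr).2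
      (fun s hs => ((he r' (hr.trans hrr')).2 s (hsub hs)).mono hsub) ?_
    rw [(he r hr).1, (he r' (hr.trans hrr')).1]
  -- The value at `s` is read off the local solution of radius `|s - t| + 1`. By `agree`, near `s`
  -- all these choices coincide with the single solution of radius `|s - t| + 2`, which yields the
  -- derivative.
  refine ⟨fun s => e (|s - t| + 1) s, (he _ (by positivity)).1, fun s => ?_⟩
  set r := |s - t| + 2
  have hr : 0 ≤ r := by positivity
  have hs := abs_le.1 (le_refl |s - t|)
  have h1 := ((he r hr).2 s ⟨by simp only [r]; linarith, by simp only [r]; linarith⟩).hasDerivAt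
    (Icc_mem_nhds (by simp only [r]; linarith) (by simp only [r]; linarith))
  have heq : ∀ s', |s' - s| < 1 → e (|s' - t| + 1) s' = e r s' := by
    intro s' hs'
    have h3 := abs_le.1 (le_refl |s' - t|)
    refine agree _ _ (by positivity) ?_ s' ⟨by linarith, by linarith⟩
    have := abs_sub_le s' s t
    simp only [r]; linarith
  have h2 : (fun s => e (|s - t| + 1) s) =ᶠ[𝓝 s] e r := by
    filter_upwards [Metric.ball_mem_nhds s one_pos] with s' hs'
    exact heq s' hs'
  have h3 := h1.congr_of_eventuallyEq h2
  rwa [← heq s (by simp)] at h3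

open scoped NNReal in
theorem exists_negativeFlow {v : ℝ → ℝ → ℝ} {K : ℝ≥0} {R ε : ℝ}
    (hc : Continuous fun q : ℝ × ℝ => v q.1 q.2) (hl : ∀ t, LipschitzWith K (v t))
    (hb : ∀ t x, |v t x| ≤ R) (hε : 0 < ε) (hn : ∀ t x, v t x ≤ -ε) :
    ∃ f : NegativeFlow, f.speed = v := by
  choose c h1 h2 using exists_global_solution hc hl hb
  exact ⟨⟨v, fun s t x => c t x s, K, R, ε, hε, hc, hl, hb, hn, h1, fun s t x => h2 t x s⟩, rfl⟩

namespace NegativeFlow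

variable (f : NegativeFlow)

theorem gap_le_bound : f.gap ≤ f.bound := by
  have h1 := f.speed_le 0 0
  have h2 := (abs_le.1 (f.abs_speed_le 0 0)).1
  linarith

theorem bound_pos : 0 < f.bound := f.gap_pos.trans_le f.gap_le_bound

theorem eq_flow {a b t x : ℝ} (ht : t ∈ Icc a b) {c : ℝ → ℝ}
    (hc : ∀ s ∈ Icc a b, HasDerivWithinAt c (f.speed s (c s)) (Icc a b) s) (h : c t = x) :
    ∀ s ∈ Icc a b, c s = f.flow s t x :=
  solution_eq_of_eq f.lipschitz_speed ht hc
    (fun s _ => (f.hasDerivAt_flow s t x).hasDerivWithinAt) (by rw [h, f.flow_self])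

theorem flow_flow (r s t x : ℝ) : f.flow r s (f.flow s t x) = f.flow r t x := by
  refine (f.eq_flow (a := min r s) (b := max r s) (t := s) ⟨min_le_right _ _, le_max_right _ _⟩
    (c := fun r => f.flow r t x) (fun r _ => (f.hasDerivAt_flow r t x).hasDerivWithinAt) rfl r
    ⟨min_le_left _ _, le_max_left _ _⟩).symm

theorem abs_flow_sub_flow_le (s t x x' : ℝ) :
    |f.flow s t x - f.flow s t x'| ≤ |x - x'| * Real.exp (f.lip * |s - t|) := by
  have hd : ∀ x, ∀ a b : ℝ, ∀ s ∈ Icc a b, HasDerivWithinAt (fun s => f.flow s t x)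
      (f.speed s (f.flow s t x)) (Icc a b) s :=
    fun x a b s _ => (f.hasDerivAt_flow s t x).hasDerivWithinAt
  rcases le_total s t with h | h
  · have := dist_solution_le_backward f.lipschitz_speed (hd x s t) (hd x' s t) s ⟨le_rfl, h⟩
    rw [abs_sub_comm s t, abs_of_nonneg (sub_nonneg.2 h)]
    simpa [f.flow_self] using this
  · have := dist_solution_le_forward f.lipschitz_speed (hd x t s) (hd x' t s) s ⟨h, le_rfl⟩
    rw [abs_of_nonneg (sub_nonneg.2 h)]
    simpa [f.flow_self] using this

theorem abs_sub_le_flow (s t x x' : ℝ) :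
    |x - x'| ≤ |f.flow s t x - f.flow s t x'| * Real.exp (f.lip * |s - t|) := by
  have := f.abs_flow_sub_flow_le t s (f.flow s t x) (f.flow s t x')
  rwa [f.flow_flow, f.flow_flow, f.flow_self, f.flow_self, abs_sub_comm t s] at this

theorem differentiable_flow (t x : ℝ) : Differentiable ℝ fun s => f.flow s t x :=
  fun s => (f.hasDerivAt_flow s t x).differentiableAt

theorem flow_sub_flow_le {s s' : ℝ} (h : s ≤ s') (t x : ℝ) :
    f.flow s' t x - f.flow s t x ≤ -f.gap * (s' - s) := by
  refine image_sub_le_mul_sub_of_deriv_le (f.differentiable_flow t x) (fun r => ?_) h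
  rw [(f.hasDerivAt_flow r t x).deriv]
  exact f.speed_le _ _

theorem abs_flow_sub_le (s s' t x : ℝ) :
    |f.flow s' t x - f.flow s t x| ≤ f.bound * |s' - s| :=
  Convex.norm_image_sub_le_of_norm_deriv_le (f := fun s => f.flow s t x) (s := univ)
    (fun r _ => f.differentiable_flow t x r)
    (fun r _ => by rw [(f.hasDerivAt_flow r t x).deriv]; exact f.abs_speed_le _ _)
    convex_univ (mem_univ _) (mem_univ _)

theorem gap_mul_abs_le (s s' t x : ℝ) :
    f.gap * |s' - s| ≤ |f.flow s' t x - f.flow s t x| := by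
  wlog h : s ≤ s' generalizing s s'
  · rw [abs_sub_comm s', abs_sub_comm (f.flow s' t x)]
    exact this s' s (le_of_not_ge h)
  rw [abs_of_nonneg (sub_nonneg.2 h)]
  have := f.flow_sub_flow_le h t x
  have h2 := neg_le_abs (f.flow s' t x - f.flow s t x)
  linarith

theorem strictAnti_flow_time (t x : ℝ) : StrictAnti fun s => f.flow s t x := by
  intro s s' h
  have := f.flow_sub_flow_le h.le t x
  have h2 := mul_pos f.gap_pos (sub_pos.2 h)
  simp only
  linarith

theorem continuous_flow : Continuous fun q : ℝ × ℝ × ℝ => f.flow q.1 q.2.1 q.2.2 := by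
  rw [continuous_iff_continuousAt]
  rintro ⟨s, t, x⟩
  -- An explicit modulus of continuity: moving `s` costs the speed bound, and moving `(t, x)`
  -- amounts to a change of position at time `t`, which the flow amplifies by the Grönwall factor.
  have hb : ∀ q : ℝ × ℝ × ℝ, |f.flow q.1 q.2.1 q.2.2 - f.flow s t x| ≤
      f.bound * |q.1 - s| + (f.bound * |t - q.2.1| + |q.2.2 - x|) * Real.exp (f.lip * |s - t|) := by
    rintro ⟨s', t', x'⟩
    simp only
    have h1 := f.abs_flow_sub_le s s' t' x'
    have h2 := f.abs_flow_sub_flow_le s t (f.flow t t' x') x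
    rw [f.flow_flow] at h2
    have h3 := f.abs_flow_sub_le t' t t' x'
    rw [f.flow_self] at h3
    have h4 := abs_sub_le (f.flow s' t' x') (f.flow s t' x') (f.flow s t x)
    have h5 := abs_sub_le (f.flow t t' x') x' x
    have h6 : |f.flow t t' x' - x| * Real.exp (f.lip * |s - t|) ≤
      (f.bound * |t - t'| + |x' - x|) * Real.exp (f.lip * |s - t|) := by
      gcongr; linarith
    linarith
  rw [ContinuousAt, tendsto_iff_norm_sub_tendsto_zero]
  refine squeeze_zero (fun _ => norm_nonneg _) hb ?_
  have : Continuous fun q : ℝ × ℝ × ℝ => f.bound * |q.1 - s| +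
      (f.bound * |t - q.2.1| + |q.2.2 - x|) * Real.exp (f.lip * |s - t|) := by fun_prop
  have h0 := this.tendsto (s, t, x)
  simpa using h0

/-- Distinct trajectories never meet, so by the intermediate value theorem in time their difference
keeps its sign. -/
theorem strictMono_flow (s t : ℝ) : StrictMono fun x => f.flow s t x := by
  have hcont : Continuous fun x => f.flow s t x :=
    f.continuous_flow.comp (continuous_const.prodMk (continuous_const.prodMk continuous_id))
  have hinj : Function.Injective fun x => f.flow s t x := by
    intro x x' h
    have := congrArg (f.flow t s) h
    simpa only [f.flow_flow, f.flow_self] using this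
  intro x x' hx
  by_contra hcon
  simp only [not_lt] at hcon
  have hne : ∀ r, f.flow r t x' - f.flow r t x ≠ 0 := by
    intro r hr
    have h := congrArg (f.flow t r) (sub_eq_zero.1 hr)
    simp only [f.flow_flow, f.flow_self] at h
    exact hx.ne' h
  have hc : Continuous fun r => f.flow r t x' - f.flow r t x :=
    (f.differentiable_flow t x').continuous.sub (f.differentiable_flow t x).continuous
  have h0 : (0 : ℝ) ∈ uIcc (f.flow s t x' - f.flow s t x) (f.flow t t x' - f.flow t t x) := by
    rw [f.flow_self, f.flow_self, uIcc_of_le (by linarith)]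
    exact ⟨by linarith, by linarith⟩
  obtain ⟨r, -, hr⟩ := intermediate_value_uIcc hc.continuousOn h0
  exact hne r hr

theorem exists_hit (a t x : ℝ) : ∃ s, f.flow s t x = a := by
  have hc := (f.differentiable_flow t x).continuous
  -- At speed at least `gap` the distance `|x - a|` is covered within time `d`, so `a` is reached in
  -- `[t - d, t + d]`.
  set d := |x - a| / f.gap
  have hd : f.gap * d = |x - a| := by
    simp only [d]; field_simp [f.gap_pos.ne']
  have hd0 : 0 ≤ d := div_nonneg (abs_nonneg _) f.gap_pos.le
  have h1 := f.flow_sub_flow_le (s := t - d) (s' := t) (by linarith) t x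
  have h2 := f.flow_sub_flow_le (s := t) (s' := t + d) (by linarith) t x
  rw [f.flow_self] at h1 h2
  have h3 := neg_abs_le (x - a)
  have h4 := le_abs_self (x - a)
  obtain ⟨s, -, hs⟩ := intermediate_value_uIcc (a := t + d) (b := t - d) hc.continuousOn
    (show a ∈ uIcc _ _ by
      rw [uIcc_of_le] <;> [skip; nlinarith]
      constructor <;> nlinarith)
  exact ⟨s, hs⟩

/-- The time at which the characteristic through `x` at time `t` is at position `a`. -/
noncomputable def hit (a t x : ℝ) : ℝ := (f.exists_hit a t x).choose

@[simp] theorem flow_hit (a t x : ℝ) : f.flow (f.hit a t x) t x = a := (f.exists_hit a t x).choose_spec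

theorem hit_eq {a s t x : ℝ} (h : f.flow s t x = a) : f.hit a t x = s :=
  (f.strictAnti_flow_time t x).injective (by simp only [flow_hit, h])

@[simp] theorem hit_self (t x : ℝ) : f.hit x t x = t := f.hit_eq (f.flow_self t x)

theorem hit_flow (a s t x : ℝ) : f.hit a s (f.flow s t x) = f.hit a t x :=
  f.hit_eq (by rw [f.flow_flow, f.flow_hit])

theorem lt_hit_iff {a s t x : ℝ} : s < f.hit a t x ↔ a < f.flow s t x := by
  conv_rhs => rw [← f.flow_hit a t x]
  exact ((f.strictAnti_flow_time t x).lt_iff_gt).symm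

theorem hit_lt_iff {a s t x : ℝ} : f.hit a t x < s ↔ f.flow s t x < a := by
  conv_rhs => rw [← f.flow_hit a t x]
  exact ((f.strictAnti_flow_time t x).lt_iff_gt).symm

theorem le_hit_iff {a s t x : ℝ} : s ≤ f.hit a t x ↔ a ≤ f.flow s t x := by
  rw [← not_lt, ← not_lt, hit_lt_iff]

theorem hit_le_iff {a s t x : ℝ} : f.hit a t x ≤ s ↔ f.flow s t x ≤ a := by
  rw [← not_lt, ← not_lt, lt_hit_iff]

theorem abs_hit_sub_time_le (a t x : ℝ) : f.gap * |f.hit a t x - t| ≤ |a - x| := by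
  have := f.gap_mul_abs_le t (f.hit a t x) t x
  rwa [f.flow_hit, f.flow_self] at this

theorem gap_mul_abs_hit_sub_hit_le (a t x x' : ℝ) : f.gap * |f.hit a t x - f.hit a t x'| ≤
    |x - x'| * Real.exp (f.lip * |f.hit a t x - t|) := by
  have h1 := f.gap_mul_abs_le (f.hit a t x') (f.hit a t x) t x'
  have h2 := f.abs_flow_sub_flow_le (f.hit a t x) t x x'
  rw [f.flow_hit] at h1 h2
  rw [abs_sub_comm] at h2
  exact h1.trans h2

theorem continuous_hit : Continuous fun q : ℝ × ℝ × ℝ => f.hit q.1 q.2.1 q.2.2 := by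
  rw [continuous_iff_continuousAt]
  rintro ⟨a, t, x⟩
  have hb : ∀ q : ℝ × ℝ × ℝ, |f.hit q.1 q.2.1 q.2.2 - f.hit a t x| ≤
      |f.flow (f.hit a t x) q.2.1 q.2.2 - q.1| / f.gap := by
    rintro ⟨a', t', x'⟩
    rw [le_div_iff₀' f.gap_pos]
    have h1 := f.gap_mul_abs_le (f.hit a t x) (f.hit a' t' x') t' x'
    rw [f.flow_hit, abs_sub_comm a'] at h1
    exact h1
  rw [ContinuousAt, tendsto_iff_norm_sub_tendsto_zero]
  refine squeeze_zero (fun _ => norm_nonneg _) hb ?_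
  have hc := f.continuous_flow
  have : Continuous fun q : ℝ × ℝ × ℝ => |f.flow (f.hit a t x) q.2.1 q.2.2 - q.1| / f.gap := by
    have : Continuous fun q : ℝ × ℝ × ℝ => f.flow (f.hit a t x) q.2.1 q.2.2 :=
      hc.comp (continuous_const.prodMk continuous_snd)
    fun_prop
  have h0 := this.tendsto (a, t, x)
  simpa using h0

theorem strictMono_hit (a t : ℝ) : StrictMono fun x => f.hit a t x := by
  intro x x' h
  simp only [f.lt_hit_iff]
  have := f.strictMono_flow (f.hit a t x) t h
  simpa using this

/-- Lower Lipschitz bound of the hitting time in space. -/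
theorem abs_sub_le_hit (a t x x' : ℝ) : |x - x'| ≤
    f.bound * |f.hit a t x - f.hit a t x'| * Real.exp (f.lip * |f.hit a t x - t|) := by
  have h1 := f.abs_sub_le_flow (f.hit a t x) t x x'
  have h2 := f.abs_flow_sub_le (f.hit a t x') (f.hit a t x) t x'
  rw [f.flow_hit, abs_sub_comm] at h2
  rw [f.flow_hit] at h1
  exact h1.trans (by gcongr)

/-- Lipschitz bounds of the hitting time in the starting time. -/
theorem gap_mul_abs_hit_sub_hit_time_le (a t t' x : ℝ) : f.gap * |f.hit a t x - f.hit a t' x| ≤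
    f.bound * |t - t'| * Real.exp (f.lip * |f.hit a t x - t|) := by
  have h1 := f.gap_mul_abs_hit_sub_hit_le a t x (f.flow t t' x)
  rw [f.hit_flow] at h1
  refine h1.trans ?_
  gcongr
  have := f.abs_flow_sub_le t' t t' x
  rwa [f.flow_self, abs_sub_comm] at this

end NegativeFlow

/-! ### Null sets, convergence and integrals under expanding or Lipschitz maps -/

open scoped NNReal in
theorem volume_image_le_of_lipschitzOn {g : ℝ → ℝ} {s : Set ℝ} {C : ℝ≥0}
    (h : LipschitzOnWith C g s) : volume (g '' s) ≤ C * volume s := by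
  have := h.hausdorffMeasure_image_le (d := 1) zero_le_one
  simpa [← hausdorffMeasure_real] using this

open scoped NNReal in
-- The inverse of an expanding map is Lipschitz on the image, and Lipschitz maps enlarge Lebesgue
-- measure by at most their constant.
theorem volume_inter_preimage_le {φ : ℝ → ℝ} {I : Set ℝ} {C : ℝ}
    (h : ∀ x ∈ I, ∀ x' ∈ I, |x - x'| ≤ C * |φ x - φ x'|) (A : Set ℝ) :
    volume (I ∩ φ ⁻¹' A) ≤ ENNReal.ofReal C * volume A := by
  have hinv : ∀ x ∈ I, Function.invFunOn φ I (φ x) = x := by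
    intro x hx
    have h1 := Function.invFunOn_mem (f := φ) (s := I) (b := φ x) ⟨x, hx, rfl⟩
    have h2 := Function.invFunOn_eq (f := φ) (s := I) (b := φ x) ⟨x, hx, rfl⟩
    have h3 := h _ h1 x hx
    rw [h2, sub_self, abs_zero, mul_zero] at h3
    linarith [abs_nonpos_iff.1 h3]
  have hlip : LipschitzOnWith C.toNNReal (Function.invFunOn φ I) (A ∩ φ '' I) := by
    refine LipschitzOnWith.of_dist_le_mul ?_
    rintro _ ⟨-, x, hx, rfl⟩ _ ⟨-, x', hx', rfl⟩
    rw [hinv x hx, hinv x' hx']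
    exact (h x hx x' hx').trans (mul_le_mul_of_nonneg_right (Real.le_coe_toNNReal C) (abs_nonneg _))
  calc volume (I ∩ φ ⁻¹' A) ≤ volume (Function.invFunOn φ I '' (A ∩ φ '' I)) := by
        refine measure_mono ?_
        rintro x ⟨hx, hA⟩
        exact ⟨φ x, ⟨hA, x, hx, rfl⟩, hinv x hx⟩
    _ ≤ C.toNNReal * volume (A ∩ φ '' I) := volume_image_le_of_lipschitzOn hlip
    _ ≤ _ := mul_le_mul' le_rfl (measure_mono inter_subset_left)

/-- Almost everywhere statements are pulled back by expanding maps. -/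
theorem ae_comp_of_expanding {φ : ℝ → ℝ} {I : Set ℝ} {C : ℝ}
    (h : ∀ x ∈ I, ∀ x' ∈ I, |x - x'| ≤ C * |φ x - φ x'|) {P : ℝ → Prop}
    (hP : ∀ᵐ y, P y) : ∀ᵐ x, x ∈ I → P (φ x) := by
  have h1 := volume_inter_preimage_le h {y | ¬ P y}
  rw [ae_iff.1 hP, mul_zero] at h1
  rw [ae_iff]
  refine measure_mono_null ?_ (nonpos_iff_eq_zero.1 h1)
  intro x hx
  simp only [mem_ofPred_eq, Classical.not_imp] at hx
  exact hx

/-- For continuous `f` this is pointwise convergence. In general `f` is replaced by an `L²`-close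
continuous `g k`; the uniform expansion keeps the bad set of `f - g k` small after pullback by every
`φ n`. -/
theorem tendstoInMeasure_comp_of_tendsto_id {I J : Set ℝ} (hI : MeasurableSet I) (hIJ : I ⊆ J)
    (hIfin : volume I ≠ ∞) {f : ℝ → ℝ} (hf : MemLp f 2 (volume.restrict J))
    (hJ : MeasurableSet J) (hJfin : volume J ≠ ∞)
    {φ : ℕ → ℝ → ℝ} {C : ℝ} (hφ : ∀ n, Measurable (φ n)) (hmaps : ∀ n, ∀ x ∈ I, φ n x ∈ J)
    (hexp : ∀ n, ∀ x ∈ I, ∀ x' ∈ I, |x - x'| ≤ C * |φ n x - φ n x'|)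
    (hid : ∀ x ∈ I, Tendsto (fun n => φ n x) atTop (𝓝 x)) :
    TendstoInMeasure (volume.restrict I) (fun n x => f (φ n x)) atTop f := by
  have : IsFiniteMeasure (volume.restrict I) := ⟨by simpa using hIfin.lt_top⟩
  have : IsFiniteMeasure (volume.restrict J) := ⟨by simpa using hJfin.lt_top⟩
  have happ : ∀ k : ℕ, ∃ g : ℝ → ℝ, eLpNorm (g - f) 2 (volume.restrict J) ≤ ENNReal.ofReal (1 / ((k : ℝ) + 1)) ∧
      Continuous g ∧ MemLp g 2 (volume.restrict J) := by
    intro k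
    obtain ⟨g, -, h1, h2, h3⟩ := hf.exists_hasCompactSupport_eLpNorm_sub_le (by simp)
      (ε := ENNReal.ofReal (1 / ((k : ℝ) + 1))) (by
        rw [Ne, ENNReal.ofReal_eq_zero, not_le]; positivity)
    exact ⟨g, by rwa [eLpNorm_sub_comm], h2, h3⟩
  choose g hg1 hg2 hg3 using happ
  have hglim : TendstoInMeasure (volume.restrict J) g atTop f := by
    refine tendstoInMeasure_of_tendsto_eLpNorm (p := 2) (by simp)
      (fun k => (hg3 k).aestronglyMeasurable) hf.aestronglyMeasurable ?_
    refine tendsto_of_tendsto_of_tendsto_of_le_of_le tendsto_const_nhds ?_ (fun _ => zero_le) hg1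
    have := ENNReal.tendsto_ofReal (tendsto_one_div_add_atTop_nhds_zero_nat (𝕜 := ℝ))
    simpa using this
  rw [tendstoInMeasure_iff_dist] at hglim ⊢
  intro ε hε
  rw [ENNReal.tendsto_nhds_zero]
  intro δ hδ
  have hc0 : Tendsto (fun k => ENNReal.ofReal C * volume.restrict J {x | ε / 3 ≤ dist (g k x) (f x)} +
      volume.restrict J {x | ε / 3 ≤ dist (g k x) (f x)}) atTop (𝓝 0) := by
    have h := hglim (ε / 3) (by positivity)
    have h1 := ENNReal.Tendsto.const_mul (a := ENNReal.ofReal C) h (Or.inr ENNReal.ofReal_ne_top)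
    simpa using h1.add h
  obtain ⟨k, hk⟩ := ((ENNReal.tendsto_nhds_zero.1 hc0) (δ / 2) (ENNReal.half_pos hδ.ne')).exists
  have hmid : TendstoInMeasure (volume.restrict I) (fun n x => g k (φ n x)) atTop (g k) := by
    refine tendstoInMeasure_of_tendsto_ae
      (fun n => ((hg2 k).measurable.comp (hφ n)).aestronglyMeasurable) ?_
    filter_upwards [ae_restrict_mem hI] with x hx
    exact ((hg2 k).tendsto x).comp (hid x hx)
  rw [tendstoInMeasure_iff_dist] at hmid
  have hmid' := (ENNReal.tendsto_nhds_zero.1 (hmid (ε / 3) (by positivity))) (δ / 2)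
    (ENNReal.half_pos hδ.ne')
  filter_upwards [hmid'] with n hn
  set B := {x | ε / 3 ≤ dist (g k x) (f x)}
  -- The three sets of an `ε/3` argument: `f` far from `g k` at `φ n x`, `f` far from `g k` at `x`,
  -- and `g k` moving too much between the two points.
  have hsub : {x | ε ≤ dist (f (φ n x)) (f x)} ∩ I ⊆
      (I ∩ φ n ⁻¹' (B ∩ J)) ∪ (B ∩ J) ∪ ({x | ε / 3 ≤ dist (g k (φ n x)) (g k x)} ∩ I) := by
    rintro x ⟨hx, hxI⟩
    by_contra hcon
    simp only [mem_union, mem_inter_iff, mem_preimage, hxI, hIJ hxI, hmaps n x hxI, and_true,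
      true_and, not_or, B, mem_ofPred_eq, not_le] at hcon hx
    have h1 := dist_triangle4 (f (φ n x)) (g k (φ n x)) (g k x) (f x)
    rw [dist_comm (f (φ n x)) (g k (φ n x))] at h1
    linarith [hcon.1.1, hcon.1.2, hcon.2]
  have hB : volume.restrict J B = volume (B ∩ J) := Measure.restrict_apply' hJ
  rw [Measure.restrict_apply' hI]
  rw [Measure.restrict_apply' hI] at hn
  calc volume ({x | ε ≤ dist (f (φ n x)) (f x)} ∩ I)
      ≤ (volume (I ∩ φ n ⁻¹' (B ∩ J)) + volume (B ∩ J)) +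
        volume ({x | ε / 3 ≤ dist (g k (φ n x)) (g k x)} ∩ I) :=
        (measure_mono hsub).trans ((measure_union_le _ _).trans
          (add_le_add (measure_union_le _ _) le_rfl))
    _ ≤ (ENNReal.ofReal C * volume (B ∩ J) + volume (B ∩ J)) + δ / 2 :=
        add_le_add (add_le_add (volume_inter_preimage_le (hexp n) _) le_rfl) hn
    _ ≤ δ / 2 + δ / 2 := by rw [hB] at hk; exact add_le_add hk le_rfl
    _ = δ := ENNReal.add_halves δ

/-- If `fₙ → f` in `L²(J)` and the uniformly expanding maps `φₙ : I → J` tend to the identity, then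
a subsequence of `fₙ ∘ φₙ` tends to `f` almost everywhere on `I`. -/
theorem exists_subseq_tendsto_comp {I J : Set ℝ} (hI : MeasurableSet I) (hIJ : I ⊆ J)
    (hJ : MeasurableSet J) (hJfin : volume J ≠ ∞)
    {F : ℕ → ℝ → ℝ} {f : ℝ → ℝ} (hf : MemLp f 2 (volume.restrict J))
    (hF : ∀ n, AEStronglyMeasurable (F n) (volume.restrict J))
    (hlim : Tendsto (fun n => eLpNorm (fun x => F n x - f x) 2 (volume.restrict J)) atTop (𝓝 0))
    {φ : ℕ → ℝ → ℝ} {C : ℝ} (hφ : ∀ n, Measurable (φ n)) (hmaps : ∀ n, ∀ x ∈ I, φ n x ∈ J)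
    (hexp : ∀ n, ∀ x ∈ I, ∀ x' ∈ I, |x - x'| ≤ C * |φ n x - φ n x'|)
    (hid : ∀ x ∈ I, Tendsto (fun n => φ n x) atTop (𝓝 x)) :
    ∃ ns : ℕ → ℕ, StrictMono ns ∧ ∀ᵐ x ∂volume.restrict I,
      Tendsto (fun k => F (ns k) (φ (ns k) x)) atTop (𝓝 (f x)) := by
  have hIfin : volume I ≠ ∞ := ((measure_mono hIJ).trans_lt hJfin.lt_top).ne
  have h1 := tendstoInMeasure_comp_of_tendsto_id hI hIJ hIfin hf hJ hJfin hφ hmaps hexp hid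
  have h2 : TendstoInMeasure (volume.restrict J) F atTop f :=
    tendstoInMeasure_of_tendsto_eLpNorm (p := 2) (by simp) hF hf.aestronglyMeasurable hlim
  suffices h : TendstoInMeasure (volume.restrict I) (fun n x => F n (φ n x)) atTop f from
    h.exists_seq_tendsto_ae
  rw [tendstoInMeasure_iff_dist] at h1 h2 ⊢
  intro ε hε
  have hup : Tendsto (fun n => ENNReal.ofReal C * volume.restrict J {x | ε / 2 ≤ dist (F n x) (f x)} +
      volume.restrict I {x | ε / 2 ≤ dist (f (φ n x)) (f x)}) atTop (𝓝 0) := by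
    have h3 := ENNReal.Tendsto.const_mul (a := ENNReal.ofReal C) (h2 (ε / 2) (by positivity))
      (Or.inr ENNReal.ofReal_ne_top)
    simpa using h3.add (h1 (ε / 2) (by positivity))
  refine tendsto_of_tendsto_of_tendsto_of_le_of_le tendsto_const_nhds hup (fun _ => zero_le) ?_
  intro n
  simp only
  rw [Measure.restrict_apply' hI, Measure.restrict_apply' hI, Measure.restrict_apply' hJ]
  refine le_trans (measure_mono ?_) ((measure_union_le _ _).trans
    (add_le_add (volume_inter_preimage_le (hexp n) _) le_rfl))
  rintro x ⟨hx, hxI⟩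
  by_contra hcon
  simp only [mem_union, mem_inter_iff, mem_preimage, hxI, hmaps n x hxI, and_true,
    true_and, not_or, mem_ofPred_eq, not_le] at hcon hx
  linarith [dist_triangle (F n (φ n x)) (f (φ n x)) (f x), hcon.1, hcon.2]

open scoped NNReal in
/-- Change of variables for a strictly increasing map that is Lipschitz on `[0,1]`. -/
theorem integral_comp_strictMono_lipschitzOn {θ : ℝ → ℝ} (hm : StrictMono θ) (hc : Continuous θ)
    {L : ℝ≥0} (hL : LipschitzOnWith L θ (Icc 0 1)) (F : ℝ → ℝ) :
    ∫ x in (θ 0)..(θ 1), F x = ∫ η in (0 : ℝ)..1, deriv θ η * F (θ η) := by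
  have hd : ∀ᵐ η, η ∈ Ioo (0 : ℝ) 1 → DifferentiableAt ℝ θ η := by
    filter_upwards [hL.ae_differentiableWithinAt_of_mem_real] with η h hη
    exact (h (Ioo_subset_Icc_self hη)).differentiableAt (Icc_mem_nhds hη.1 hη.2)
  set D : Set ℝ := Ioo 0 1 ∩ {η | DifferentiableAt ℝ θ η} with hDdef
  have hD : MeasurableSet D := measurableSet_Ioo.inter (measurableSet_of_differentiableAt ℝ θ)
  have hDae : D =ᵐ[volume] Ioo (0 : ℝ) 1 := by
    filter_upwards [hd] with η h
    apply propext
    exact ⟨fun h' => h'.1, fun h' => ⟨h', h h'⟩⟩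
  -- The points of `(0,1)` where `θ` is not differentiable form a null set, and its Lipschitz image
  -- is null. Restricting to `D` therefore loses nothing on either side of the substitution.
  have himg : θ '' D =ᵐ[volume] Ioo (θ 0) (θ 1) := by
    have hIoo : Ioo (θ 0) (θ 1) ⊆ θ '' D ∪ θ '' (Ioo 0 1 \ D) := by
      rw [← image_union, union_sdiff_self]
      exact (intermediate_value_Ioo zero_le_one hc.continuousOn).trans
        (image_mono subset_union_right)
    have hnull : volume (θ '' (Ioo 0 1 \ D)) = 0 := by
      have h1 := volume_image_le_of_lipschitzOn
        (hL.mono (sdiff_subset.trans Ioo_subset_Icc_self : Ioo (0 : ℝ) 1 \ D ⊆ Icc 0 1))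
      have h2 : volume (Ioo (0 : ℝ) 1 \ D) = 0 := (ae_le_set.1 hDae.symm.le)
      rw [h2, mul_zero] at h1
      exact nonpos_iff_eq_zero.1 h1
    refine Filter.EventuallyLE.antisymm (LE.le.eventuallyLE ?_) ?_
    · rintro _ ⟨η, hη, rfl⟩
      exact ⟨hm hη.1.1, hm hη.1.2⟩
    · rw [ae_le_set]
      refine measure_mono_null ?_ hnull
      rintro x ⟨hx, hx'⟩
      exact (hIoo hx).resolve_left hx'
  rw [intervalIntegral.integral_of_le (hm zero_lt_one).le, intervalIntegral.integral_of_le zero_le_one,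
    integral_Ioc_eq_integral_Ioo, integral_Ioc_eq_integral_Ioo, ← setIntegral_congr_set himg,
    ← setIntegral_congr_set hDae,
    integral_image_eq_integral_abs_deriv_smul hD (fun η hη => hη.2.hasDerivAt.hasDerivWithinAt)
      hm.injective.injOn]
  refine setIntegral_congr_fun hD (fun η _ => ?_)
  simp only [smul_eq_mul]
  rw [abs_of_nonneg (hm.monotone.deriv_nonneg)]

theorem ae_prod_ae {A B : Set ℝ} {P : ℝ × ℝ → Prop}
    (h : ∀ᵐ q ∂(volume.restrict (A ×ˢ B) : Measure (ℝ × ℝ)), P q) :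
    ∀ᵐ t ∂volume.restrict A, ∀ᵐ x ∂volume.restrict B, P (t, x) := by
  rw [Measure.volume_eq_prod, ← Measure.prod_restrict] at h
  exact Measure.ae_ae_of_ae_prod h

theorem ae_prod_ae_swap {A B : Set ℝ} {P : ℝ × ℝ → Prop}
    (h : ∀ᵐ q ∂(volume.restrict (A ×ˢ B) : Measure (ℝ × ℝ)), P q) :
    ∀ᵐ x ∂volume.restrict B, ∀ᵐ t ∂volume.restrict A, P (t, x) := by
  rw [Measure.volume_eq_prod, ← Measure.prod_restrict] at h
  have h1 := (Measure.measurePreserving_swap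
    (μ := volume.restrict B) (ν := volume.restrict A)).quasiMeasurePreserving.ae h
  exact Measure.ae_ae_of_ae_prod h1

/-- Arbitrarily close to an end of an interval there are points where an almost everywhere
property holds. -/
theorem exists_seq_of_ae {a b : ℝ} (hab : a < b) {P : ℝ → Prop}
    (h : ∀ᵐ x ∂volume.restrict (Ioo a b), P x) (r : ℝ) (hr : 0 < r) :
    ∃ x : ℕ → ℝ, (∀ n, x n ∈ Ioo a b ∧ x n < a + r ∧ P (x n)) ∧ Tendsto x atTop (𝓝 a) := by
  have ex : ∀ n : ℕ, ∃ x, x ∈ Ioo a b ∧ x < a + r ∧ x < a + 1 / ((n : ℝ) + 1) ∧ P x := by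
    intro n
    have hpos : (0 : ℝ) < 1 / ((n : ℝ) + 1) := by positivity
    set c := min b (min (a + r) (a + 1 / ((n : ℝ) + 1)))
    have hc : a < c := lt_min hab (lt_min (by linarith) (by linarith))
    have h1 : ∀ᵐ x ∂volume.restrict (Ioo a c), P x :=
      ae_restrict_of_ae_restrict_of_subset (Ioo_subset_Ioo_right (min_le_left _ _)) h
    have hne : NeBot (ae (volume.restrict (Ioo a c))) := by
      rw [ae_neBot, Ne, Measure.restrict_eq_zero]
      simp [hc]
    obtain ⟨x, hx, hP⟩ := ((ae_restrict_mem measurableSet_Ioo).and h1).exists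
    exact ⟨x, ⟨hx.1, hx.2.trans_le (min_le_left _ _)⟩,
      hx.2.trans_le ((min_le_right _ _).trans (min_le_left _ _)),
      hx.2.trans_le ((min_le_right _ _).trans (min_le_right _ _)), hP⟩
  choose x h1 h2 h3 h4 using ex
  refine ⟨x, fun n => ⟨h1 n, h2 n, h4 n⟩, ?_⟩
  refine tendsto_of_tendsto_of_tendsto_of_le_of_le tendsto_const_nhds ?_ (fun n => (h1 n).1.le)
    (fun n => (h3 n).le)
  simpa using (tendsto_one_div_add_atTop_nhds_zero_nat (𝕜 := ℝ)).const_add a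

theorem ae_restrict_of_forall_nat {s : Set ℝ} {I : ℕ → Set ℝ} {P : ℝ → Prop}
    (hs : s ⊆ ⋃ n, I n) (h : ∀ n, ∀ᵐ x ∂volume.restrict (I n), P x) :
    ∀ᵐ x ∂volume.restrict s, P x :=
  ae_restrict_of_ae_restrict_of_subset hs ((ae_restrict_iUnion_iff I P).2 h)

/-! ### Traces at the boundary and sections at fixed times -/

namespace NegativeFlow

variable (f : NegativeFlow)

theorem hit_hit (a b t x : ℝ) : f.hit b (f.hit a t x) a = f.hit b t x := by
  have := f.hit_flow b (f.hit a t x) t x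
  rwa [f.flow_hit] at this

/-- A crossing of a length at most `1` takes time at most `1 / gap`. All Grönwall factors for
crossings of `[0,1]` are thus bounded independently of time. -/
theorem exp_lip_le {d : ℝ} (h : f.gap * d ≤ 1) :
    Real.exp (f.lip * d) ≤ Real.exp (f.lip / f.gap) := by
  apply Real.exp_le_exp.2
  rw [div_eq_mul_one_div]
  refine mul_le_mul_of_nonneg_left ?_ f.lip.coe_nonneg
  rw [le_div_iff₀' f.gap_pos]
  exact h

/-- The map from the passage time at `b` to the passage time at `a` has an inverse of the same type,
which is Lipschitz by the two-sided speed bound and Grönwall. -/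
theorem hit_expanding {a b : ℝ} (hab : |b - a| ≤ 1) (τ τ' : ℝ) :
    |τ - τ'| ≤ f.bound / f.gap * Real.exp (f.lip / f.gap) * |f.hit a τ b - f.hit a τ' b| := by
  have h1 := f.gap_mul_abs_hit_sub_hit_time_le b (f.hit a τ b) (f.hit a τ' b) a
  rw [f.hit_hit, f.hit_hit, f.hit_self, f.hit_self] at h1
  have h2 := f.abs_hit_sub_time_le a τ b
  rw [abs_sub_comm a, abs_sub_comm] at h2
  have h3 := f.exp_lip_le (h2.trans hab)
  have h4 : f.gap * |τ - τ'| ≤ f.bound * |f.hit a τ b - f.hit a τ' b| *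
      Real.exp (f.lip / f.gap) := h1.trans
    (mul_le_mul_of_nonneg_left h3 (mul_nonneg f.bound_pos.le (abs_nonneg _)))
  rw [← le_div_iff₀' f.gap_pos] at h4
  refine h4.trans (le_of_eq ?_)
  ring

theorem hit_space_expanding (a t : ℝ) {x : ℝ} (hx : |a - x| ≤ 1) (x' : ℝ) :
    |x - x'| ≤ f.bound * Real.exp (f.lip / f.gap) * |f.hit a t x - f.hit a t x'| := by
  have h1 := f.abs_sub_le_hit a t x x'
  have h2 := f.exp_lip_le ((f.abs_hit_sub_time_le a t x).trans hx)
  have h3 := mul_le_mul_of_nonneg_left h2 (mul_nonneg f.bound_pos.le (abs_nonneg (f.hit a t x - f.hit a t x')))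
  refine h1.trans (h3.trans (le_of_eq ?_))
  ring

/-- Trace at `x = 0` of a function that is, up to a continuous function vanishing at `x = 0`,
constant along the characteristics. -/
theorem ae_trace_eq {t0 : ℝ} {y w : ℝ → ℝ → ℝ} {β : ℝ → ℝ}
    (hw : Continuous fun q : ℝ × ℝ => w q.1 q.2) (hw0 : ∀ t, w t 0 = 0)
    (hβ : ∀ᵐ q : ℝ × ℝ ∂(volume.restrict (Ioi t0 ×ˢ Ioo (0 : ℝ) 1)),
      y q.1 q.2 - w q.1 q.2 = β (f.hit 0 q.1 q.2))
    (hmem : ∀ T > 0, ∀ x ∈ Icc (0 : ℝ) 1,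
      MemLp (fun t => y t x) 2 (volume.restrict (Ioo t0 (t0 + T))))
    (hcont : ∀ T > 0, Tendsto (fun x => eLpNorm (fun t => y t x - y t 0) 2
      (volume.restrict (Ioo t0 (t0 + T)))) (𝓝[Icc 0 1] 0) (𝓝 0)) :
    ∀ᵐ τ ∂volume.restrict (Ioi t0), y τ 0 = β τ := by
  refine ae_restrict_of_forall_nat
    (I := fun N : ℕ => Ioo (t0 + 1 / ((N : ℝ) + 1)) (t0 + ((N : ℝ) + 1))) ?_ ?_
  · intro τ hτ
    have hpos : 0 < τ - t0 := sub_pos.2 hτ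
    obtain ⟨N, hN⟩ := exists_nat_gt (max (1 / (τ - t0)) (τ - t0))
    have h1 := (le_max_left _ _).trans_lt hN
    have h2 := (le_max_right _ _).trans_lt hN
    rw [mem_iUnion]
    refine ⟨N, ?_, by linarith⟩
    have h3 : 1 / ((N : ℝ) + 1) < τ - t0 := by
      rw [one_div_lt (by positivity) hpos]; linarith
    linarith
  intro N
  set a := t0 + 1 / ((N : ℝ) + 1) with ha
  set T := (N : ℝ) + 1 with hT
  have hTpos : 0 < T := by positivity
  have hapos : 0 < a - t0 := by simp only [ha]; ring_nf; positivity
  -- Positions decreasing to `0` in the limit, on which the equation holds for almost every time.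
  -- The bound `gap * (a - t0)` ensures that a characteristic arriving at `x = 0` after `a` passes
  -- `x n` after `t0`.
  obtain ⟨x, hx, hx0⟩ := exists_seq_of_ae zero_lt_one (ae_prod_ae_swap hβ) (f.gap * (a - t0))
    (mul_pos f.gap_pos hapos)
  have hx01 : ∀ n, x n ∈ Icc (0 : ℝ) 1 := fun n => Ioo_subset_Icc_self (hx n).1
  have hle : ∀ n τ, f.hit (x n) τ 0 ≤ τ := by
    intro n τ
    rw [f.hit_le_iff, f.flow_self]
    exact (hx01 n).1
  have hdist : ∀ n τ, f.gap * |f.hit (x n) τ 0 - τ| ≤ x n := by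
    intro n τ
    have := f.abs_hit_sub_time_le (x n) τ 0
    rwa [sub_zero, abs_of_nonneg (hx01 n).1] at this
  have hmaps : ∀ n, ∀ τ ∈ Ioo a (t0 + T), f.hit (x n) τ 0 ∈ Ioo t0 (t0 + T) := by
    intro n τ hτ
    refine ⟨?_, (hle n τ).trans_lt hτ.2⟩
    have h1 := (hdist n τ).trans_lt (hx n).2.1
    rw [zero_add, mul_lt_mul_iff_right₀ f.gap_pos] at h1
    have h2 := neg_abs_le (f.hit (x n) τ 0 - τ)
    linarith [hτ.1]
  have hexp : ∀ n, ∀ τ ∈ Ioo a (t0 + T), ∀ τ' ∈ Ioo a (t0 + T), |τ - τ'| ≤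
      f.bound / f.gap * Real.exp (f.lip / f.gap) * |f.hit (x n) τ 0 - f.hit (x n) τ' 0| := by
    intro n τ _ τ' _
    refine f.hit_expanding ?_ τ τ'
    rw [zero_sub, abs_neg, abs_of_nonneg (hx01 n).1]
    exact (hx01 n).2
  have hid : ∀ τ, Tendsto (fun n => f.hit (x n) τ 0) atTop (𝓝 τ) := by
    intro τ
    have h := (f.continuous_hit.tendsto (0, τ, 0)).comp
      (hx0.prodMk_nhds (tendsto_const_nhds (x := ((τ, 0) : ℝ × ℝ))))
    simpa [Function.comp_def] using h
  obtain ⟨ns, hns, hlim⟩ := exists_subseq_tendsto_comp (I := Ioo a (t0 + T)) (J := Ioo t0 (t0 + T))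
    (F := fun n t => y t (x n)) (f := fun t => y t 0) (φ := fun n τ => f.hit (x n) τ 0)
    measurableSet_Ioo (Ioo_subset_Ioo_left (by linarith)) measurableSet_Ioo (by simp)
    (hmem T hTpos 0 ⟨le_rfl, zero_le_one⟩)
    (fun n => (hmem T hTpos (x n) (hx01 n)).aestronglyMeasurable)
    ((hcont T hTpos).comp (tendsto_nhdsWithin_iff.2 ⟨hx0, Eventually.of_forall hx01⟩))
    (fun n => (f.continuous_hit.comp
      (continuous_const.prodMk (continuous_id.prodMk continuous_const))).measurable)
    hmaps hexp (fun τ _ => hid τ)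
  -- Evaluation on the line `x = x n` at the passage time of the characteristic that arrives at `x =
  -- 0` at time `τ`; the right-hand side no longer depends on `n`.
  have hpull : ∀ᵐ τ, ∀ n, τ ∈ Ioo a (t0 + T) →
      y (f.hit (x n) τ 0) (x n) - w (f.hit (x n) τ 0) (x n) = β τ := by
    rw [ae_all_iff]
    intro n
    have h1 := (ae_restrict_iff' measurableSet_Ioi).1 (hx n).2.2
    filter_upwards [ae_comp_of_expanding (hexp n) h1] with τ h2 hτ
    have h3 := h2 hτ (hmaps n τ hτ).1
    rwa [f.hit_hit, f.hit_self] at h3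
  filter_upwards [hlim, ae_restrict_of_ae hpull, ae_restrict_mem measurableSet_Ioo] with τ h1 h2 h3
  have h4 : Tendsto (fun k => w (f.hit (x (ns k)) τ 0) (x (ns k))) atTop (𝓝 0) := by
    have h := (hw.tendsto (τ, 0)).comp ((hid τ).prodMk_nhds hx0)
    simp only [hw0] at h
    exact h.comp hns.tendsto_atTop
  have h5 := h1.sub h4
  simp only [h2 _ h3, sub_zero] at h5
  exact tendsto_nhds_unique h5 tendsto_const_nhds

/-- The section at every time of a function that is, up to a continuous function,
constant along the characteristics. -/
theorem ae_section_eq {t0 : ℝ} {y w : ℝ → ℝ → ℝ} {β : ℝ → ℝ}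
    (hw : Continuous fun q : ℝ × ℝ => w q.1 q.2)
    (hβ : ∀ᵐ q : ℝ × ℝ ∂(volume.restrict (Ioi t0 ×ˢ Ioo (0 : ℝ) 1)),
      y q.1 q.2 - w q.1 q.2 = β (f.hit 0 q.1 q.2))
    (hmem : ∀ t, t0 ≤ t → MemLp (y t) 2 (volume.restrict (Ioo (0 : ℝ) 1)))
    (hcont : ∀ t, t0 ≤ t → Tendsto (fun s => eLpNorm (fun x => y s x - y t x) 2
      (volume.restrict (Ioo (0 : ℝ) 1))) (𝓝[Ici t0] t) (𝓝 0)) (s : ℝ) (hs : t0 ≤ s) :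
    ∀ᵐ ξ ∂volume.restrict (Ioo (0 : ℝ) 1), y s ξ - w s ξ = β (f.hit 0 s ξ) := by
  refine ae_restrict_of_forall_nat
    (I := fun N : ℕ => Ioo (1 / ((N : ℝ) + 1)) (1 - 1 / ((N : ℝ) + 1))) ?_ ?_
  · intro ξ hξ
    have hpos : 0 < min ξ (1 - ξ) := lt_min hξ.1 (sub_pos.2 hξ.2)
    obtain ⟨N, hN⟩ := exists_nat_gt (1 / min ξ (1 - ξ))
    rw [mem_iUnion]
    have h3 : 1 / ((N : ℝ) + 1) < min ξ (1 - ξ) := by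
      rw [one_div_lt (by positivity) hpos]; linarith
    have h1 := h3.trans_le (min_le_left _ _)
    have h2 := h3.trans_le (min_le_right _ _)
    exact ⟨N, h1, by linarith⟩
  intro N
  set d := 1 / ((N : ℝ) + 1) with hd
  have hdpos : 0 < d := by positivity
  -- Good times tending to `s` from above. Within `d / bound` a characteristic drifts by less than
  -- `d`, so it stays in `(0,1)` when it starts from `(d, 1 - d)`.
  obtain ⟨r, hr, hr0⟩ := exists_seq_of_ae (lt_add_one s)
    (ae_restrict_of_ae_restrict_of_subset
      (Ioo_subset_Ioi_self.trans (Ioi_subset_Ioi hs)) (ae_prod_ae hβ)) (d / f.bound)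
    (div_pos hdpos f.bound_pos)
  have hdist : ∀ n ξ, |f.flow (r n) s ξ - ξ| < d := by
    intro n ξ
    have h1 := f.abs_flow_sub_le s (r n) s ξ
    rw [f.flow_self, abs_of_nonneg (sub_nonneg.2 (hr n).1.1.le)] at h1
    refine h1.trans_lt ?_
    rw [← lt_div_iff₀' f.bound_pos]
    linarith [(hr n).2.1]
  have hmaps : ∀ n, ∀ ξ ∈ Ioo d (1 - d), f.flow (r n) s ξ ∈ Ioo (0 : ℝ) 1 := by
    intro n ξ hξ
    have h1 := abs_lt.1 (hdist n ξ)
    exact ⟨by linarith [hξ.1], by linarith [hξ.2]⟩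
  have hexp : ∀ n, ∀ ξ ∈ Ioo d (1 - d), ∀ ξ' ∈ Ioo d (1 - d), |ξ - ξ'| ≤
      Real.exp f.lip * |f.flow (r n) s ξ - f.flow (r n) s ξ'| := by
    intro n ξ _ ξ' _
    rw [mul_comm]
    refine (f.abs_sub_le_flow (r n) s ξ ξ').trans
      (mul_le_mul_of_nonneg_left (Real.exp_le_exp.2 ?_) (abs_nonneg _))
    refine mul_le_of_le_one_right f.lip.coe_nonneg ?_
    rw [abs_of_nonneg (sub_nonneg.2 (hr n).1.1.le)]
    linarith [(hr n).1.2]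
  have hid : ∀ ξ, Tendsto (fun n => f.flow (r n) s ξ) atTop (𝓝 ξ) := by
    intro ξ
    have h := ((f.differentiable_flow s ξ).continuous.tendsto s).comp hr0
    simpa [Function.comp_def, f.flow_self] using h
  have hrt : ∀ n, t0 ≤ r n := fun n => hs.trans (hr n).1.1.le
  obtain ⟨ns, hns, hlim⟩ := exists_subseq_tendsto_comp (I := Ioo d (1 - d)) (J := Ioo 0 1)
    (F := fun n x => y (r n) x) (f := y s) (φ := fun n ξ => f.flow (r n) s ξ)
    measurableSet_Ioo (Ioo_subset_Ioo hdpos.le (by linarith)) measurableSet_Ioo (by simp)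
    (hmem s hs) (fun n => (hmem (r n) (hrt n)).aestronglyMeasurable)
    ((hcont s hs).comp (tendsto_nhdsWithin_iff.2 ⟨hr0, Eventually.of_forall hrt⟩))
    (fun n => (f.continuous_flow.comp
      (continuous_const.prodMk (continuous_const.prodMk continuous_id))).measurable)
    hmaps hexp (fun ξ _ => hid ξ)
  have hpull : ∀ᵐ ξ, ∀ n, ξ ∈ Ioo d (1 - d) →
      y (r n) (f.flow (r n) s ξ) - w (r n) (f.flow (r n) s ξ) = β (f.hit 0 s ξ) := by
    rw [ae_all_iff]
    intro n
    have h1 := (ae_restrict_iff' measurableSet_Ioo).1 (hr n).2.2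
    filter_upwards [ae_comp_of_expanding (hexp n) h1] with ξ h2 hξ
    have h3 := h2 hξ (hmaps n ξ hξ)
    rwa [f.hit_flow] at h3
  filter_upwards [hlim, ae_restrict_of_ae hpull, ae_restrict_mem measurableSet_Ioo] with ξ h1 h2 h3
  have h4 : Tendsto (fun k => w (r (ns k)) (f.flow (r (ns k)) s ξ)) atTop (𝓝 (w s ξ)) :=
    ((hw.tendsto (s, ξ)).comp (hr0.prodMk_nhds (hid ξ))).comp hns.tendsto_atTop
  have h5 := h1.sub h4
  simp only [h2 _ h3] at h5
  exact tendsto_nhds_unique h5 tendsto_const_nhds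

end NegativeFlow

/-! ### Extension of the coefficients to the plane -/

/-- Extension of a function from the strip `[0,+∞) × [0,1]` to `ℝ × ℝ`. -/
noncomputable def clampStrip (g : ℝ → ℝ → ℝ) (t x : ℝ) : ℝ := g (max t 0) (max 0 (min x 1))

theorem clamp_mem (x : ℝ) : max 0 (min x 1) ∈ Icc (0 : ℝ) 1 :=
  ⟨le_max_left _ _, max_le zero_le_one (min_le_right _ _)⟩

theorem clampStrip_eq (g : ℝ → ℝ → ℝ) {t x : ℝ} (ht : 0 ≤ t) (hx : x ∈ Icc (0 : ℝ) 1) :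
    clampStrip g t x = g t x := by
  rw [clampStrip, max_eq_left ht, min_eq_left hx.2, max_eq_right hx.1]

theorem continuous_clampStrip {g : ℝ → ℝ → ℝ}
    (hg : ContinuousOn (fun q : ℝ × ℝ => g q.1 q.2) closedStrip) :
    Continuous fun q : ℝ × ℝ => clampStrip g q.1 q.2 := by
  refine hg.comp_continuous (f := fun q : ℝ × ℝ => (max q.1 0, max 0 (min q.2 1))) (by fun_prop) ?_
  intro q
  exact ⟨mem_Ici.2 (le_max_right _ _), clamp_mem _⟩

theorem lipschitz_clamp (x x' : ℝ) : |max 0 (min x 1) - max 0 (min x' 1)| ≤ |x - x'| := by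
  refine (abs_max_sub_max_le_max _ _ _ _).trans ?_
  rw [sub_self, abs_zero, max_eq_right (abs_nonneg _)]
  refine (abs_min_sub_min_le_max _ _ _ _).trans ?_
  simp

/-- Clamping is `1`-Lipschitz and takes values in the strip. The extended speed thus inherits the
sign and size bounds, and the bound on `∂ₓλ` becomes a global Lipschitz constant in `x`, which gives
a global flow. -/
theorem AdmissibleSpeeds.exists_flow {m p : ℕ} {lam : ℝ → ℝ → Fin m ⊕ Fin p → ℝ}
    (h : AdmissibleSpeeds lam) (i : Fin m) :
    ∃ f : NegativeFlow, f.speed = clampStrip fun t x => lam t x (Sum.inl i) := by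
  obtain ⟨R, hR⟩ := h.bounded
  obtain ⟨ε, hε, hsep⟩ := h.separated
  have hcont := h.contDiff (Sum.inl i)
  refine exists_negativeFlow (K := R.toNNReal) (R := R) (ε := ε)
    (continuous_clampStrip hcont.continuousOn) (fun t => ?_)
    (fun t x => (hR (Sum.inl i) _ _ (le_max_right _ _) (clamp_mem x)).1) hε
    (fun t x => ((hsep _ _ (le_max_right _ _) (clamp_mem x)).1 i).le)
  have ht : 0 ≤ max t 0 := le_max_right _ _
  have hd : DifferentiableOn ℝ (fun x => lam (max t 0) x (Sum.inl i)) (Icc 0 1) := by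
    refine (hcont.differentiableOn one_ne_zero).comp
      (f := fun x : ℝ => (max t 0, x)) ?_ (fun x hx => ⟨ht, hx⟩)
    exact ((differentiable_const _).prodMk differentiable_id).differentiableOn
  refine LipschitzWith.of_dist_le_mul fun x x' => ?_
  have h1 := (convex_Icc (0 : ℝ) 1).norm_image_sub_le_of_norm_derivWithin_le hd
    (fun z hz => (hR (Sum.inl i) _ _ ht hz).2) (clamp_mem x') (clamp_mem x)
  have hR0 : 0 ≤ R := (abs_nonneg _).trans (hR (Sum.inl i) _ _ ht (clamp_mem x)).1
  rw [Real.coe_toNNReal R hR0]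
  exact h1.trans (mul_le_mul_of_nonneg_left (lipschitz_clamp x x') hR0)

/-! ### Volterra terms along the characteristics and their kernels -/

/-- The solution of `∂ₜ wᵢ + λᵢ ∂ₓ wᵢ = ∑ⱼ gᵢⱼ uⱼ(t)`, `wᵢ(t,0) = 0`. -/
noncomputable def sourceTerm {m : ℕ} (f : Fin m → NegativeFlow) (g : Fin m → Fin m → ℝ → ℝ → ℝ)
    (u : Fin m → ℝ → ℝ) (i : Fin m) (t x : ℝ) : ℝ :=
  -∫ r in t..(f i).hit 0 t x, ∑ j, g i j r ((f i).flow r t x) * u j r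

open Classical in
/-- The kernel which expresses `sourceTerm` through the values at time `s` of the functions
transported along the characteristics towards the trace `u`. -/
noncomputable def sourceKernel {m : ℕ} (f : Fin m → NegativeFlow)
    (g : Fin m → Fin m → ℝ → ℝ → ℝ) (i j : Fin m) (s ξ η : ℝ) : ℝ :=
  -- The derivative of the arrival time is controlled only on `(0,1)`; cutting off outside makes the
  -- kernel bounded everywhere. The second condition encodes the upper limit of the source integral.
  if η ∈ Ioo (0 : ℝ) 1 ∧ (f j).hit 0 s η < (f i).hit 0 s ξ then
    g i j ((f j).hit 0 s η) ((f i).flow ((f j).hit 0 s η) s ξ) *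
      deriv (fun x => (f j).hit 0 s x) η
  else 0

section SourceTerm

variable {m : ℕ} (f : Fin m → NegativeFlow) {g : Fin m → Fin m → ℝ → ℝ → ℝ}
  {u : Fin m → ℝ → ℝ}

theorem sourceTerm_zero (i : Fin m) (t : ℝ) : sourceTerm f g u i t 0 = 0 := by
  simp [sourceTerm]

theorem sourceTerm_flow (i : Fin m) (s t x : ℝ) :
    sourceTerm f g u i s ((f i).flow s t x) =
      -∫ r in s..(f i).hit 0 t x, ∑ j, g i j r ((f i).flow r t x) * u j r := by
  simp only [sourceTerm, NegativeFlow.hit_flow, NegativeFlow.flow_flow]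

theorem intervalIntegrable_sum {ι : Type*} (s : Finset ι) {h : ι → ℝ → ℝ} {a b : ℝ}
    (hh : ∀ j ∈ s, IntervalIntegrable (h j) volume a b) :
    IntervalIntegrable (fun r => ∑ j ∈ s, h j r) volume a b := by
  have := IntervalIntegrable.sum s hh
  rwa [show ∑ j ∈ s, h j = fun r => ∑ j ∈ s, h j r from funext fun r => Finset.sum_apply r s h]
    at this

theorem intervalIntegrable_continuous_mul {h v : ℝ → ℝ} (hh : Continuous h)
    (hv : LocallyIntegrable v) (a b : ℝ) :
    IntervalIntegrable (fun r => h r * v r) volume a b := by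
  have h1 : IntervalIntegrable v volume a b := (hv.integrableOn_isCompact isCompact_uIcc).intervalIntegrable
  exact h1.continuousOn_mul hh.continuousOn

theorem intervalIntegrable_source (hg : ∀ i j, Continuous fun q : ℝ × ℝ => g i j q.1 q.2)
    (hu : ∀ j, LocallyIntegrable (u j)) (i : Fin m)
    (t x a b : ℝ) :
    IntervalIntegrable (fun r => ∑ j, g i j r ((f i).flow r t x) * u j r) volume a b := by
  exact intervalIntegrable_sum _ fun j _ => intervalIntegrable_continuous_mul ((hg i j).comp
    (continuous_id.prodMk ((f i).differentiable_flow t x).continuous)) (hu j) a b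

/-- The trace is only locally integrable, but it enters through a primitive whose coefficients and
limits are continuous in `(t, x)`, so dominated convergence applies. Continuity is what lets the
source term pass to the limit in traces and sections. -/
theorem continuous_sourceTerm {C : ℝ} (hg : ∀ i j, Continuous fun q : ℝ × ℝ => g i j q.1 q.2)
    (hC : ∀ i j t x, |g i j t x| ≤ C) (hu : ∀ j, LocallyIntegrable (u j)) (i : Fin m) :
    Continuous fun q : ℝ × ℝ => sourceTerm f g u i q.1 q.2 := by
  set F : ℝ × ℝ → ℝ → ℝ := fun q r => ∑ j, g i j r ((f i).flow r q.1 q.2) * u j r with hF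
  have hint : ∀ q a b, IntervalIntegrable (F q) volume a b :=
    fun q a b => intervalIntegrable_source f hg hu i q.1 q.2 a b
  have hprim : Continuous fun p : (ℝ × ℝ) × ℝ => ∫ r in (0 : ℝ)..p.2, F p.1 r := by
    rw [continuous_iff_continuousAt]
    rintro ⟨q, b⟩
    refine intervalIntegral.continuousAt_parametric_primitive_of_dominated
      (fun r => ∑ j, C * |u j r|) (-(|b| + 1)) (|b| + 1) ?_ ?_ ?_ ?_ ?_ ?_ (by simp)
    · exact fun q => (hint q _ _).def'.aestronglyMeasurable
    · refine Eventually.of_forall fun q => Eventually.of_forall fun r => ?_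
      refine (norm_sum_le _ _).trans (Finset.sum_le_sum fun j _ => ?_)
      rw [norm_mul, Real.norm_eq_abs, Real.norm_eq_abs]
      exact mul_le_mul_of_nonneg_right (hC _ _ _ _) (abs_nonneg _)
    · exact intervalIntegrable_sum _ fun j _ =>
        (((hu j).integrableOn_isCompact isCompact_uIcc).intervalIntegrable.abs).const_mul C
    · refine Eventually.of_forall fun r => ?_
      refine Continuous.continuousAt ?_
      refine continuous_finsetSum _ fun j _ => Continuous.mul ?_ continuous_const
      exact (hg i j).comp (continuous_const.prodMk
        ((f i).continuous_flow.comp (continuous_const.prodMk continuous_id)))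
    · constructor <;> linarith [abs_nonneg b]
    · constructor <;> linarith [neg_abs_le b, le_abs_self b]
  have hhit : Continuous fun q : ℝ × ℝ => (f i).hit 0 q.1 q.2 :=
    (f i).continuous_hit.comp (continuous_const.prodMk continuous_id)
  have h1 := (hprim.comp (continuous_id.prodMk hhit)).sub
    (hprim.comp (continuous_id.prodMk continuous_fst))
  refine h1.neg.congr fun q => ?_
  have h2 := intervalIntegral.integral_interval_sub_left (hint q 0 ((f i).hit 0 q.1 q.2))
    (hint q 0 q.1)
  exact congrArg Neg.neg h2

theorem sourceKernel_eq_zero (hz : ∀ i j, i ≤ j → ∀ t x, g i j t x = 0) {i j : Fin m}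
    (hij : i ≤ j) (s ξ η : ℝ) : sourceKernel f g i j s ξ η = 0 := by
  simp [sourceKernel, hz i j hij]

theorem measurable_sourceKernel (hg : ∀ i j, Continuous fun q : ℝ × ℝ => g i j q.1 q.2)
    (i j : Fin m) : Measurable fun q : ℝ × ℝ × ℝ => sourceKernel f g i j q.1 q.2.1 q.2.2 := by
  have h1 : Continuous fun q : ℝ × ℝ × ℝ => (f j).hit 0 q.1 q.2.2 :=
    (f j).continuous_hit.comp (continuous_const.prodMk
      (continuous_fst.prodMk (continuous_snd.comp continuous_snd)))
  have h2 : Continuous fun q : ℝ × ℝ × ℝ => (f i).hit 0 q.1 q.2.1 :=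
    (f i).continuous_hit.comp (continuous_const.prodMk
      (continuous_fst.prodMk (continuous_fst.comp continuous_snd)))
  have h3 : Continuous fun q : ℝ × ℝ × ℝ => (f i).flow ((f j).hit 0 q.1 q.2.2) q.1 q.2.1 :=
    (f i).continuous_flow.comp (h1.prodMk
      (continuous_fst.prodMk (continuous_fst.comp continuous_snd)))
  have h4 : Measurable fun q : ℝ × ℝ => deriv (fun x => (f j).hit 0 q.1 x) q.2 :=
    measurable_deriv_with_param (f := fun s x => (f j).hit 0 s x)
      ((f j).continuous_hit.comp (continuous_const.prodMk continuous_id))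
  refine Measurable.ite ?_ ?_ measurable_const
  · exact (measurableSet_Ioo.preimage (measurable_snd.comp measurable_snd)).inter
      (measurableSet_lt h1.measurable h2.measurable)
  · exact ((hg i j).comp (h1.prodMk h3)).measurable.mul
      (h4.comp (measurable_fst.prodMk (measurable_snd.comp measurable_snd)))

namespace NegativeFlow

/-- A Lipschitz constant on `[0,1]` of the time at which characteristics reach `x = 0`. -/
noncomputable def hitLip (f : NegativeFlow) : ℝ := Real.exp (f.lip / f.gap) / f.gap

theorem hitLip_nonneg (f : NegativeFlow) : 0 ≤ f.hitLip :=
  div_nonneg (Real.exp_pos _).le f.gap_pos.le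

theorem lipschitzOn_hit (f : NegativeFlow) (s : ℝ) :
    LipschitzOnWith f.hitLip.toNNReal (fun x => f.hit 0 s x) (Icc 0 1) := by
  refine LipschitzOnWith.of_dist_le_mul fun x hx x' _ => ?_
  rw [Real.coe_toNNReal _ f.hitLip_nonneg]
  have h1 := f.gap_mul_abs_hit_sub_hit_le 0 s x x'
  have h2 := f.abs_hit_sub_time_le 0 s x
  have hx1 : |0 - x| ≤ 1 := by rw [zero_sub, abs_neg, abs_of_nonneg hx.1]; exact hx.2
  have h3 := mul_le_mul_of_nonneg_left (f.exp_lip_le (h2.trans hx1)) (abs_nonneg (x - x'))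
  rw [Real.dist_eq, Real.dist_eq, hitLip, div_mul_eq_mul_div, le_div_iff₀' f.gap_pos]
  linarith

theorem abs_deriv_hit_le (f : NegativeFlow) (s : ℝ) {η : ℝ} (hη : η ∈ Ioo (0 : ℝ) 1) :
    |deriv (fun x => f.hit 0 s x) η| ≤ f.hitLip := by
  have := norm_deriv_le_of_lipschitzOn (Icc_mem_nhds hη.1 hη.2) (f.lipschitzOn_hit s)
  rwa [Real.coe_toNNReal _ f.hitLip_nonneg] at this

end NegativeFlow

/-- The arrival time is Lipschitz in the position with a constant independent of `s`. This
uniformity makes the feedback essentially bounded and the stability constants independent of the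
initial time. -/
theorem abs_sourceKernel_le {C : ℝ} (hC : ∀ i j t x, |g i j t x| ≤ C) (i j : Fin m)
    (s ξ η : ℝ) : |sourceKernel f g i j s ξ η| ≤ C * ∑ k, (f k).hitLip := by
  have hC0 : 0 ≤ C := (abs_nonneg _).trans (hC i j 0 0)
  have hsum : (f j).hitLip ≤ ∑ k, (f k).hitLip :=
    Finset.single_le_sum (f := fun k => (f k).hitLip) (fun k _ => (f k).hitLip_nonneg)
      (Finset.mem_univ j)
  have hnn : 0 ≤ ∑ k, (f k).hitLip := (f j).hitLip_nonneg.trans hsum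
  rw [sourceKernel]
  split_ifs with h
  · rw [abs_mul]
    exact mul_le_mul (hC _ _ _ _) (((f j).abs_deriv_hit_le s h.1).trans hsum) (abs_nonneg _) hC0
  · rw [abs_zero]; exact mul_nonneg hC0 hnn

/-- Characteristics keep their order: arriving at `x = 0` after the one that leaves `x = 1` at time
`s` means having entered after `s`. -/
theorem NegativeFlow.lt_hit_one_of_hit_lt (f : NegativeFlow) {s r : ℝ} (h : f.hit 0 s 1 < r) :
    s < f.hit 1 r 0 := by
  rw [f.lt_hit_iff]
  rw [f.hit_lt_iff] at h
  have := f.strictMono_flow s r h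
  simpa only [f.flow_flow, f.flow_self] using this

/-- Representation of `sourceTerm` by its kernel, when the trace vanishes along all the
characteristics that enter the domain after time `s`. -/
theorem sourceTerm_eq_kernel (hg : ∀ i j, Continuous fun q : ℝ × ℝ => g i j q.1 q.2)
    (hu : ∀ j, LocallyIntegrable (u j))
    (hz : ∀ i j, i ≤ j → ∀ t x, g i j t x = 0) {i : Fin m} {s ξ : ℝ} (hξ : 0 ≤ ξ)
    (hs : ∀ j, j < i → ∀ᵐ r, s < (f j).hit 1 r 0 → u j r = 0) :
    sourceTerm f g u i s ξ =
      -∑ j, ∫ η in Ioo (0 : ℝ) 1, sourceKernel f g i j s ξ η * u j ((f j).hit 0 s η) := by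
  classical
  have hle : s ≤ (f i).hit 0 s ξ := by rwa [(f i).le_hit_iff, (f i).flow_self]
  have hint : ∀ j, IntervalIntegrable (fun r => g i j r ((f i).flow r s ξ) * u j r) volume s
      ((f i).hit 0 s ξ) := fun j => intervalIntegrable_continuous_mul ((hg i j).comp
        (continuous_id.prodMk ((f i).differentiable_flow s ξ).continuous)) (hu j) _ _
  rw [sourceTerm, intervalIntegral.integral_finsetSum (fun j _ => hint j)]
  congr 1
  refine Finset.sum_congr rfl fun j _ => ?_
  rcases le_or_gt i j with hij | hij
  · simp [hz i j hij, sourceKernel_eq_zero f hz hij]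
  set θ : ℝ → ℝ := fun x => (f j).hit 0 s x with hθ
  have hθm : StrictMono θ := (f j).strictMono_hit 0 s
  have hθc : Continuous θ :=
    (f j).continuous_hit.comp (continuous_const.prodMk (continuous_const.prodMk continuous_id))
  have hθ0 : θ 0 = s := (f j).hit_self s 0
  set F : ℝ → ℝ := fun r => g i j r ((f i).flow r s ξ) * u j r
  -- The upper limit is replaced by the last arrival time of `j`-characteristics already in the
  -- domain at time `s`. Beyond it the trace vanishes, and the original limit survives as a cutoff.
  have hstep : ∫ r in s..(f i).hit 0 s ξ, F r =
      ∫ r in s..θ 1, if r < (f i).hit 0 s ξ then F r else 0 := by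
    have h01 : s ≤ θ 1 := hθ0 ▸ (hθm zero_lt_one).le
    rw [intervalIntegral.integral_of_le hle, intervalIntegral.integral_of_le h01,
      ← integral_indicator measurableSet_Ioc, ← integral_indicator measurableSet_Ioc]
    refine integral_congr_ae ?_
    have hne : ∀ᵐ r : ℝ, r ≠ (f i).hit 0 s ξ := by simp [ae_iff]
    filter_upwards [hne, hs j hij] with r hr hr0
    simp only [indicator, mem_Ioc]
    by_cases h1 : s < r
    · by_cases h2 : r < (f i).hit 0 s ξ
      · by_cases h3 : r ≤ θ 1
        · simp [h1, h2, h2.le, h3]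
        · have h4 := hr0 ((f j).lt_hit_one_of_hit_lt (not_le.1 h3))
          simp [F, h4]
      · have h3 : ¬ r ≤ (f i).hit 0 s ξ := fun h => h2 (lt_of_le_of_ne h hr)
        simp [h2, h3]
    · simp [h1]
  -- Substitution `r = (f j).hit 0 s η`, which replaces the arrival time by the position at time
  -- `s`.
  have hcv := integral_comp_strictMono_lipschitzOn hθm hθc ((f j).lipschitzOn_hit s)
    (fun r => if r < (f i).hit 0 s ξ then F r else 0)
  rw [hθ0] at hcv
  rw [hstep, hcv, intervalIntegral.integral_of_le zero_le_one, integral_Ioc_eq_integral_Ioo]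
  refine setIntegral_congr_fun measurableSet_Ioo fun η hη => ?_
  simp only [sourceKernel, hη, true_and]
  by_cases h : (f j).hit 0 s η < (f i).hit 0 s ξ
  · simp only [hθ, h, if_true, F]; ring
  · simp [hθ, h]

end SourceTerm

/-! ### Resolvent of a strictly triangular kernel -/

/-- The `k`-th partial sum of the Neumann series of the resolvent of `κ`. -/
noncomputable def partialResolvent {m : ℕ} (κ : Fin m → Fin m → ℝ → ℝ → ℝ → ℝ) :
    ℕ → Fin m → Fin m → ℝ → ℝ → ℝ → ℝ
  | 0 => fun _ _ _ _ _ => 0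
  | k + 1 => fun i j s ξ ζ =>
      κ i j s ξ ζ + ∑ l, ∫ η in Ioo (0 : ℝ) 1, κ i l s ξ η * partialResolvent κ k l j s η ζ

section Resolvent

variable {m : ℕ} {κ : Fin m → Fin m → ℝ → ℝ → ℝ → ℝ}

theorem measurable_partialResolvent
    (hκ : ∀ i j, Measurable fun q : ℝ × ℝ × ℝ => κ i j q.1 q.2.1 q.2.2) (k : ℕ) (i j : Fin m) :
    Measurable fun q : ℝ × ℝ × ℝ => partialResolvent κ k i j q.1 q.2.1 q.2.2 := by
  induction k generalizing i j with
  | zero => exact measurable_const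
  | succ k ih =>
    refine (hκ i j).add (Finset.measurable_sum _ fun l _ => ?_)
    have h1 : Measurable fun q : (ℝ × ℝ × ℝ) × ℝ =>
        κ i l q.1.1 q.1.2.1 q.2 * partialResolvent κ k l j q.1.1 q.2 q.1.2.2 := by
      refine Measurable.mul ?_ ?_
      · exact (hκ i l).comp (f := fun q : (ℝ × ℝ × ℝ) × ℝ => (q.1.1, q.1.2.1, q.2)) (by fun_prop)
      · exact (ih l j).comp (f := fun q : (ℝ × ℝ × ℝ) × ℝ => (q.1.1, q.2, q.1.2.2)) (by fun_prop)
    exact (h1.stronglyMeasurable.integral_prod_right'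
      (ν := volume.restrict (Ioo (0 : ℝ) 1))).measurable

theorem abs_integral_Ioo_le {h : ℝ → ℝ} {C : ℝ} (hC : ∀ η, |h η| ≤ C) :
    |∫ η in Ioo (0 : ℝ) 1, h η| ≤ C := by
  have := norm_setIntegral_le_of_norm_le_const (μ := volume) (s := Ioo (0 : ℝ) 1) (f := h) (C := C)
    (by simp) (fun x _ => hC x)
  simpa using this

theorem exists_bound_partialResolvent {C : ℝ} (hC : ∀ i j s ξ η, |κ i j s ξ η| ≤ C) (k : ℕ) :
    ∃ D, 0 ≤ D ∧ ∀ i j s ξ ζ, |partialResolvent κ k i j s ξ ζ| ≤ D := by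
  induction k with
  | zero => exact ⟨0, le_rfl, fun _ _ _ _ _ => by simp [partialResolvent]⟩
  | succ k ih =>
    obtain ⟨D, hD0, hD⟩ := ih
    have hC' : ∀ i j s ξ η, |κ i j s ξ η| ≤ max C 0 := fun i j s ξ η =>
      (hC i j s ξ η).trans (le_max_left _ _)
    have hC0 : 0 ≤ max C 0 := le_max_right _ _
    refine ⟨max C 0 + ∑ _l : Fin m, max C 0 * D, by positivity, fun i j s ξ ζ => ?_⟩
    refine (abs_add_le _ _).trans (add_le_add (hC' _ _ _ _ _)
      ((Finset.abs_sum_le_sum_abs _ _).trans (Finset.sum_le_sum fun l _ => ?_)))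
    refine abs_integral_Ioo_le fun η => ?_
    rw [abs_mul]
    exact mul_le_mul (hC' _ _ _ _ _) (hD _ _ _ _ _) (abs_nonneg _) hC0

theorem integrable_bounded_mul {h v : ℝ → ℝ} {C : ℝ} (hh : Measurable h) (hC : ∀ η, |h η| ≤ C)
    (hv : Integrable v (volume.restrict (Ioo (0 : ℝ) 1))) :
    Integrable (fun η => h η * v η) (volume.restrict (Ioo (0 : ℝ) 1)) :=
  hv.bdd_mul hh.aestronglyMeasurable (Eventually.of_forall hC)

/-- The resolvent composed with the kernel. -/
theorem sum_integral_kernel_eq_resolvent {C : ℝ}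
    (hκ : ∀ i j, Measurable fun q : ℝ × ℝ × ℝ => κ i j q.1 q.2.1 q.2.2)
    (hC : ∀ i j s ξ η, |κ i j s ξ η| ≤ C) (hz : ∀ i j, i ≤ j → ∀ s ξ η, κ i j s ξ η = 0)
    {y v : Fin m → ℝ → ℝ} (hy : ∀ j, Integrable (y j) (volume.restrict (Ioo (0 : ℝ) 1)))
    {s : ℝ} {i : Fin m} {k : ℕ}
    (hv : ∀ l, l < i → ∀ᵐ η ∂volume.restrict (Ioo (0 : ℝ) 1), v l η = y l η +
      ∑ j, ∫ ζ in Ioo (0 : ℝ) 1, partialResolvent κ k l j s η ζ * y j ζ) (ξ : ℝ) :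
    ∑ l, ∫ η in Ioo (0 : ℝ) 1, κ i l s ξ η * v l η =
      ∑ j, ∫ ζ in Ioo (0 : ℝ) 1, partialResolvent κ (k + 1) i j s ξ ζ * y j ζ := by
  obtain ⟨D, hD0, hD⟩ := exists_bound_partialResolvent hC k
  have hRm := measurable_partialResolvent hκ k
  set μ := volume.restrict (Ioo (0 : ℝ) 1)
  have hκm : ∀ l, Measurable fun η => κ i l s ξ η := fun l =>
    (hκ i l).comp (f := fun η : ℝ => (s, ξ, η)) (by fun_prop)
  -- Bounded kernels times an integrable function: this licenses Fubini in the composition of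
  -- kernels.
  have hprod : ∀ l j, Integrable (fun q : ℝ × ℝ => κ i l s ξ q.1 *
      partialResolvent κ k l j s q.1 q.2 * y j q.2) (μ.prod μ) := by
    intro l j
    have hyj : Integrable (fun q : ℝ × ℝ => y j q.2) (μ.prod μ) := (hy j).comp_snd μ
    refine hyj.bdd_mul (c := C * D) (Measurable.aestronglyMeasurable ?_)
      (Eventually.of_forall fun q => ?_)
    · exact ((hκm l).comp measurable_fst).mul ((hRm l j).comp
        (f := fun q : ℝ × ℝ => (s, q.1, q.2)) (by fun_prop))
    · rw [norm_mul]
      exact mul_le_mul (hC _ _ _ _ _) (hD _ _ _ _ _) (norm_nonneg _)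
        ((abs_nonneg _).trans (hC i l s ξ 0))
  have h1 : ∀ l, ∫ η, κ i l s ξ η * v l η ∂μ = ∫ η, κ i l s ξ η * y l η ∂μ +
      ∑ j, ∫ ζ, (∫ η, κ i l s ξ η * partialResolvent κ k l j s η ζ ∂μ) * y j ζ ∂μ := by
    intro l
    have h2 : ∫ η, κ i l s ξ η * v l η ∂μ = ∫ η, (κ i l s ξ η * y l η +
        ∑ j, ∫ ζ, κ i l s ξ η * partialResolvent κ k l j s η ζ * y j ζ ∂μ) ∂μ := by
      refine integral_congr_ae ?_
      -- Only rows `l < i` matter, since `κ i l` vanishes otherwise; hence `hv` is assumed for those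
      -- rows only.
      rcases lt_or_ge l i with hl | hl
      · filter_upwards [hv l hl] with η hη
        rw [hη, mul_add, Finset.mul_sum]
        congr 1
        refine Finset.sum_congr rfl fun j _ => ?_
        rw [← integral_const_mul]
        simp only [mul_assoc]
      · simp [hz i l hl]
    have h3 : ∀ j, Integrable (fun η => ∫ ζ, κ i l s ξ η * partialResolvent κ k l j s η ζ * y j ζ ∂μ) μ :=
      fun j => (hprod l j).integral_prod_left
    rw [h2, integral_add (integrable_bounded_mul (hκm l) (fun η => hC _ _ _ _ _) (hy l))
      (integrable_finsetSum _ fun j _ => h3 j), integral_finsetSum _ fun j _ => h3 j]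
    congr 1
    refine Finset.sum_congr rfl fun j _ => ?_
    rw [integral_integral_swap (hprod l j)]
    simp only [integral_mul_const]
  simp only [h1, partialResolvent, add_mul, Finset.sum_add_distrib, Finset.sum_mul]
  have h4 : ∀ j, ∫ ζ, (κ i j s ξ ζ * y j ζ +
      ∑ l, (∫ η, κ i l s ξ η * partialResolvent κ k l j s η ζ ∂μ) * y j ζ) ∂μ =
      ∫ ζ, κ i j s ξ ζ * y j ζ ∂μ +
      ∑ l, ∫ ζ, (∫ η, κ i l s ξ η * partialResolvent κ k l j s η ζ ∂μ) * y j ζ ∂μ := by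
    intro j
    have h5 : ∀ l, Integrable (fun ζ =>
        (∫ η, κ i l s ξ η * partialResolvent κ k l j s η ζ ∂μ) * y j ζ) μ := by
      intro l
      have := (hprod l j).integral_prod_right
      simpa only [integral_mul_const] using this
    rw [integral_add (integrable_bounded_mul (hκm j) (fun η => hC _ _ _ _ _) (hy j))
      (integrable_finsetSum _ fun l _ => h5 l), integral_finsetSum _ fun l _ => h5 l]
  simp only [show volume.restrict (Ioo (0 : ℝ) 1) = μ from rfl, h4, Finset.sum_add_distrib]
  rw [Finset.sum_comm]

/-- Inversion of a triangular integral equation by the resolvent. -/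
theorem eq_add_resolvent {C : ℝ}
    (hκ : ∀ i j, Measurable fun q : ℝ × ℝ × ℝ => κ i j q.1 q.2.1 q.2.2)
    (hC : ∀ i j s ξ η, |κ i j s ξ η| ≤ C) (hz : ∀ i j, i ≤ j → ∀ s ξ η, κ i j s ξ η = 0)
    {y v : Fin m → ℝ → ℝ} (hy : ∀ j, Integrable (y j) (volume.restrict (Ioo (0 : ℝ) 1)))
    {s : ℝ} {n : ℕ}
    (hv : ∀ l : Fin m, l.val < n → ∀ᵐ ξ ∂volume.restrict (Ioo (0 : ℝ) 1), v l ξ = y l ξ +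
      ∑ j, ∫ η in Ioo (0 : ℝ) 1, κ l j s ξ η * v j η) (k : ℕ) (i : Fin m) (hik : i.val < k)
    (hin : i.val < n) :
    ∀ᵐ ξ ∂volume.restrict (Ioo (0 : ℝ) 1), v i ξ = y i ξ +
      ∑ j, ∫ ζ in Ioo (0 : ℝ) 1, partialResolvent κ k i j s ξ ζ * y j ζ := by
  -- Row `i` involves only earlier rows, so the truncated Neumann sum of length `k` is already exact
  -- for all rows `i < k`.
  induction k generalizing i with
  | zero => exact absurd hik (Nat.not_lt_zero _)
  | succ k ih =>
    filter_upwards [hv i hin] with ξ hξ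
    rw [hξ, sum_integral_kernel_eq_resolvent hκ hC hz hy (fun l hl => ih l
      (by have := Fin.lt_def.1 hl; omega) (by have := Fin.lt_def.1 hl; omega)) ξ]

end Resolvent

/-! ### The negative components of the closed loop system -/

/-- A bounded continuous, strictly lower triangular coupling matrix. -/
structure IsTriangularCoupling {m : ℕ} (g : Fin m → Fin m → ℝ → ℝ → ℝ) : Prop where
  continuous : ∀ i j, Continuous fun q : ℝ × ℝ => g i j q.1 q.2
  bounded : ∃ C : ℝ, ∀ i j t x, |g i j t x| ≤ C
  triangular : ∀ i j, i ≤ j → ∀ t x, g i j t x = 0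

theorem locallyIntegrable_indicator_of_memLp {t0 : ℝ} {v : ℝ → ℝ}
    (hv : ∀ T > 0, MemLp v 2 (volume.restrict (Ioo t0 (t0 + T)))) :
    LocallyIntegrable ((Ioi t0).indicator v) := by
  rw [locallyIntegrable_iff]
  intro K hK
  obtain ⟨M, hM⟩ := hK.isBounded.bddAbove
  set T := max 1 (M - t0 + 1)
  have hT : 0 < T := lt_max_of_lt_left one_pos
  have hT2 : M < t0 + T := by have := le_max_right 1 (M - t0 + 1); simp only [T]; linarith
  have h1 : IntegrableOn v (Ioo t0 (t0 + T)) :=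
    (hv T hT).integrable (by norm_num)
  have h2 : IntegrableOn ((Ioi t0).indicator v) (Ioi t0 ∩ K) := by
    refine (h1.mono_set ?_).congr_fun ?_ (measurableSet_Ioi.inter hK.measurableSet)
    · exact fun r hr => ⟨hr.1, (hM hr.2).trans_lt hT2⟩
    · exact fun r hr => (indicator_of_mem hr.1 v).symm
  have h3 : IntegrableOn ((Ioi t0).indicator v) (Iic t0 ∩ K) := by
    refine integrableOn_zero.congr_fun ?_ (measurableSet_Iic.inter hK.measurableSet)
    exact fun r hr => (indicator_of_notMem (s := Ioi t0) (notMem_Ioi.2 hr.1) v).symm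
  have h4 := h2.union h3
  rwa [← union_inter_distrib_right, union_comm, Iic_union_Ioi, univ_inter] at h4

/-- The trace at `x = 0`, extended by zero before the initial time. -/
noncomputable def zeroTrace {m : ℕ} (t0 : ℝ) (y : Fin m → ℝ → ℝ → ℝ) (j : Fin m) : ℝ → ℝ :=
  (Ioi t0).indicator fun r => y j r 0

/-- The components with negative speeds of a broad solution with initial data `y0` and boundary
values `b` at `x = 1`, coupled by the source terms `∑ⱼ gᵢⱼ yⱼ(t,0)`. -/
structure IsMinusSolution {m : ℕ} (f : Fin m → NegativeFlow) (g : Fin m → Fin m → ℝ → ℝ → ℝ)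
    (t0 : ℝ) (y0 : Fin m → ℝ → ℝ) (b : Fin m → ℝ → ℝ) (y : Fin m → ℝ → ℝ → ℝ) : Prop where
  memLp_space : ∀ i t, t0 ≤ t → MemLp (y i t) 2 (volume.restrict (Ioo (0 : ℝ) 1))
  continuous_time : ∀ i t, t0 ≤ t →
    Tendsto (fun s => eLpNorm (fun x => y i s x - y i t x) 2 (volume.restrict (Ioo (0 : ℝ) 1)))
      (𝓝[Ici t0] t) (𝓝 0)
  memLp_time : ∀ i, ∀ T > 0, ∀ x ∈ Icc (0 : ℝ) 1,
    MemLp (fun t => y i t x) 2 (volume.restrict (Ioo t0 (t0 + T)))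
  continuous_space : ∀ i, ∀ T > 0,
    Tendsto (fun x => eLpNorm (fun t => y i t x - y i t 0) 2 (volume.restrict (Ioo t0 (t0 + T))))
      (𝓝[Icc 0 1] 0) (𝓝 0)
  equation : ∀ᵐ q : ℝ × ℝ ∂(volume.restrict (Ioi t0 ×ˢ Ioo (0 : ℝ) 1)), ∀ i,
    y i q.1 q.2 =
      (if t0 < (f i).hit 1 q.1 q.2 then b i ((f i).hit 1 q.1 q.2)
        else y0 i ((f i).flow t0 q.1 q.2)) +
      ∫ r in (max t0 ((f i).hit 1 q.1 q.2))..q.1,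
        ∑ j, g i j r ((f i).flow r q.1 q.2) * zeroTrace t0 y j r

namespace NegativeFlow

theorem flow_hit_base (f : NegativeFlow) (a r t x : ℝ) :
    f.flow r (f.hit a t x) a = f.flow r t x := by
  have := f.flow_flow r (f.hit a t x) t x
  rwa [f.flow_hit] at this

theorem lt_hit_zero (f : NegativeFlow) {s ξ : ℝ} (h : 0 < ξ) : s < f.hit 0 s ξ := by
  rwa [f.lt_hit_iff, f.flow_self]

theorem hit_one_lt (f : NegativeFlow) {s ξ : ℝ} (h : ξ < 1) : f.hit 1 s ξ < s := by
  rwa [f.hit_lt_iff, f.flow_self]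

end NegativeFlow

namespace IsMinusSolution

variable {m : ℕ} {f : Fin m → NegativeFlow} {g : Fin m → Fin m → ℝ → ℝ → ℝ}
    {t0 : ℝ} {y0 : Fin m → ℝ → ℝ} {b : Fin m → ℝ → ℝ} {y : Fin m → ℝ → ℝ → ℝ}

theorem locallyIntegrable_zeroTrace (h : IsMinusSolution f g t0 y0 b y) (j : Fin m) :
    LocallyIntegrable (zeroTrace t0 y j) :=
  locallyIntegrable_indicator_of_memLp fun T hT =>
    h.memLp_time j T hT 0 ⟨le_rfl, zero_le_one⟩

/-- The value of `y - w` along the characteristic that reaches `x = 0` at time `τ`. -/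
noncomputable def characteristicValue (f : Fin m → NegativeFlow) (g : Fin m → Fin m → ℝ → ℝ → ℝ)
    (t0 : ℝ) (y0 : Fin m → ℝ → ℝ) (b : Fin m → ℝ → ℝ) (y : Fin m → ℝ → ℝ → ℝ) (i : Fin m)
    (τ : ℝ) : ℝ :=
  (if t0 < (f i).hit 1 τ 0 then b i ((f i).hit 1 τ 0) else y0 i ((f i).flow t0 τ 0)) +
      ∫ r in (max t0 ((f i).hit 1 τ 0))..τ, ∑ j, g i j r ((f i).flow r τ 0) * zeroTrace t0 y j r

/-- The source integral from the entry to time `t` and the one from `t` to the arrival at `x = 0`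
join into a single integral, which depends only on the arrival time. -/
theorem ae_sub_eq_characteristicValue (h : IsMinusSolution f g t0 y0 b y)
    (hg : IsTriangularCoupling g) (i : Fin m) :
    ∀ᵐ q : ℝ × ℝ ∂(volume.restrict (Ioi t0 ×ˢ Ioo (0 : ℝ) 1)),
      y i q.1 q.2 - sourceTerm f g (zeroTrace t0 y) i q.1 q.2 =
        characteristicValue f g t0 y0 b y i ((f i).hit 0 q.1 q.2) := by
  filter_upwards [h.equation] with q hq
  rw [hq i, characteristicValue, sourceTerm, (f i).hit_hit, (f i).flow_hit_base, sub_neg_eq_add,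
    add_assoc]
  simp only [(f i).flow_hit_base]
  rw [intervalIntegral.integral_add_adjacent_intervals
    (intervalIntegrable_source f hg.continuous h.locallyIntegrable_zeroTrace i _ _ _ _)
    (intervalIntegrable_source f hg.continuous h.locallyIntegrable_zeroTrace i _ _ _ _)]

theorem continuous_source (h : IsMinusSolution f g t0 y0 b y)
    (hg : IsTriangularCoupling g) (i : Fin m) :
    Continuous fun q : ℝ × ℝ => sourceTerm f g (zeroTrace t0 y) i q.1 q.2 := by
  obtain ⟨C, hC⟩ := hg.bounded
  exact continuous_sourceTerm f hg.continuous hC h.locallyIntegrable_zeroTrace i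

/-- The source term vanishes at `x = 0`, so the trace of `y - w` there is that of `y`. -/
theorem ae_zeroTrace_eq (h : IsMinusSolution f g t0 y0 b y)
    (hg : IsTriangularCoupling g) (i : Fin m) :
    ∀ᵐ τ, t0 < τ → zeroTrace t0 y i τ = characteristicValue f g t0 y0 b y i τ := by
  have h1 := (f i).ae_trace_eq (h.continuous_source hg i) (sourceTerm_zero f i)
    (h.ae_sub_eq_characteristicValue hg i) (h.memLp_time i) (h.continuous_space i)
  filter_upwards [(ae_restrict_iff' measurableSet_Ioi).1 h1] with τ h2 hτ
  rw [← h2 hτ]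
  exact indicator_of_mem (mem_Ioi.2 hτ) _

/-- The arrival time is an expanding function of the position, so null sets of arrival times pull
back to null sets of positions. -/
theorem ae_comp_hit {i : Fin m} {P : ℝ → Prop} (hP : ∀ᵐ τ, P τ) (s : ℝ) :
    ∀ᵐ ξ ∂volume.restrict (Ioo (0 : ℝ) 1), P ((f i).hit 0 s ξ) := by
  rw [ae_restrict_iff' measurableSet_Ioo]
  refine ae_comp_of_expanding (C := (f i).bound * Real.exp ((f i).lip / (f i).gap)) ?_ hP
  intro x hx x' _
  refine (f i).hit_space_expanding 0 s ?_ x'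
  rw [zero_sub, abs_neg, abs_of_pos hx.1]
  exact hx.2.le

/-- At every time, `y - w` is the transport of the trace. -/
theorem ae_section_eq (h : IsMinusSolution f g t0 y0 b y)
    (hg : IsTriangularCoupling g) (i : Fin m) {s : ℝ} (hs : t0 ≤ s) :
    ∀ᵐ ξ ∂volume.restrict (Ioo (0 : ℝ) 1),
      zeroTrace t0 y i ((f i).hit 0 s ξ) = y i s ξ - sourceTerm f g (zeroTrace t0 y) i s ξ := by
  have h1 := (f i).ae_section_eq (h.continuous_source hg i)
    (h.ae_sub_eq_characteristicValue hg i) (h.memLp_space i) (h.continuous_time i) s hs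
  filter_upwards [h1, ae_comp_hit (h.ae_zeroTrace_eq hg i) s, ae_restrict_mem measurableSet_Ioo]
    with ξ h2 h3 h4
  rw [h2, h3 (hs.trans_lt ((f i).lt_hit_zero h4.1))]

/-- The prescribed data `y0` appear here instead of the section `y(t0,·)`: characteristics inside
the domain at time `t0` start from `y0`, so their arrival value is `y0` plus the whole source
integral. -/
theorem ae_initial_eq (h : IsMinusSolution f g t0 y0 b y)
    (hg : IsTriangularCoupling g) (i : Fin m) :
    ∀ᵐ ξ ∂volume.restrict (Ioo (0 : ℝ) 1),
      zeroTrace t0 y i ((f i).hit 0 t0 ξ) = y0 i ξ - sourceTerm f g (zeroTrace t0 y) i t0 ξ := by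
  filter_upwards [ae_comp_hit (h.ae_zeroTrace_eq hg i) t0, ae_restrict_mem measurableSet_Ioo]
    with ξ h3 h4
  have h5 := (f i).hit_one_lt (s := t0) h4.2
  rw [h3 ((f i).lt_hit_zero h4.1), characteristicValue, sourceTerm]
  simp only [(f i).hit_hit, (f i).flow_hit_base, (f i).flow_self, not_lt.2 h5.le, if_false,
    max_eq_left h5.le, sub_neg_eq_add]

theorem ae_section_eq_kernel (h : IsMinusSolution f g t0 y0 b y)
    (hg : IsTriangularCoupling g) {i : Fin m}
    (hu : ∀ j, j < i → ∀ᵐ r, t0 < (f j).hit 1 r 0 → zeroTrace t0 y j r = 0)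
    {s ξ : ℝ} (hs : t0 ≤ s) (hξ : 0 ≤ ξ) :
    sourceTerm f g (zeroTrace t0 y) i s ξ = -∑ j, ∫ η in Ioo (0 : ℝ) 1,
      sourceKernel f g i j s ξ η * zeroTrace t0 y j ((f j).hit 0 s η) := by
  refine sourceTerm_eq_kernel f hg.continuous h.locallyIntegrable_zeroTrace hg.triangular hξ ?_
  intro j hj
  filter_upwards [hu j hj] with r hr hsr
  exact hr (hs.trans_lt hsr)

theorem integrable_section (h : IsMinusSolution f g t0 y0 b y) (j : Fin m) {s : ℝ}
    (hs : t0 ≤ s) : Integrable (y j s) (volume.restrict (Ioo (0 : ℝ) 1)) :=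
  (h.memLp_space j s hs).integrable (by norm_num)

/-- The feedback law prescribes the boundary values of the source terms. -/
theorem boundary_eq_sourceTerm (h : IsMinusSolution f g t0 y0 b y)
    (hg : IsTriangularCoupling g)
    (hb : ∀ i s, t0 ≤ s → b i s = -∑ j, ∫ ξ in Ioo (0 : ℝ) 1,
      partialResolvent (sourceKernel f g) (m + 1) i j s 1 ξ * y j s ξ) {i : Fin m}
    (hu : ∀ j, j < i → ∀ᵐ r, t0 < (f j).hit 1 r 0 → zeroTrace t0 y j r = 0)
    {s : ℝ} (hs : t0 ≤ s) : b i s = sourceTerm f g (zeroTrace t0 y) i s 1 := by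
  obtain ⟨C, hC⟩ := hg.bounded
  rw [hb i s hs, h.ae_section_eq_kernel hg hu hs zero_le_one,
    sum_integral_kernel_eq_resolvent (y := fun j => y j s)
    (v := fun j η => zeroTrace t0 y j ((f j).hit 0 s η)) (measurable_sourceKernel f hg.continuous)
    (abs_sourceKernel_le f hC) (fun i j => sourceKernel_eq_zero f hg.triangular)
    (fun j => h.integrable_section j hs) (k := m) ?_ 1]
  intro l hl
  -- Only rows below `i` are inverted, as the vanishing of late traces is so far known only for
  -- indices below `i`. Length `m` is enough for each of them.
  refine eq_add_resolvent (n := i.val) (v := fun j η => zeroTrace t0 y j ((f j).hit 0 s η))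
    (measurable_sourceKernel f hg.continuous)
    (abs_sourceKernel_le f hC) (fun i j => sourceKernel_eq_zero f hg.triangular)
    (fun j => h.integrable_section j hs) ?_ m l l.isLt (Fin.lt_def.1 hl)
  intro l' hl'
  filter_upwards [h.ae_section_eq hg l' hs, ae_restrict_mem measurableSet_Ioo] with ξ h1 h2
  rw [h1, h.ae_section_eq_kernel hg (fun j hj => hu j (hj.trans (Fin.lt_def.2 hl'))) hs h2.1.le,
    sub_neg_eq_add]

/-- The trace vanishes along the characteristics that enter the domain after the initial time. -/
theorem ae_zeroTrace_eq_zero (h : IsMinusSolution f g t0 y0 b y)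
    (hg : IsTriangularCoupling g)
    (hb : ∀ i s, t0 ≤ s → b i s = -∑ j, ∫ ξ in Ioo (0 : ℝ) 1,
      partialResolvent (sourceKernel f g) (m + 1) i j s 1 ξ * y j s ξ) (i : Fin m) :
    ∀ᵐ r, t0 < (f i).hit 1 r 0 → zeroTrace t0 y i r = 0 := by
  induction i using WellFoundedLT.induction with
  | ind i ih =>
    filter_upwards [h.ae_zeroTrace_eq hg i] with τ h1 hτ
    have h2 := (f i).hit_one_lt (s := τ) zero_lt_one
    -- At the entry point `w` is minus the source integral over the whole crossing. The prescribed
    -- boundary value `w(·,1)` therefore cancels the source accumulated up to the arrival at `x =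
    -- 0`.
    have h3 := sourceTerm_flow f (g := g) (u := zeroTrace t0 y) i ((f i).hit 1 τ 0) τ 0
    rw [(f i).flow_hit, (f i).hit_self] at h3
    rw [h1 (hτ.trans h2), characteristicValue, if_pos hτ, max_eq_right hτ.le,
      h.boundary_eq_sourceTerm hg hb ih hτ.le, h3, neg_add_cancel]

/-- The source term `w` in terms of `y - w` at the same time. -/
theorem sourceTerm_eq_neg_kernel (h : IsMinusSolution f g t0 y0 b y)
    (hg : IsTriangularCoupling g)
    (hb : ∀ i s, t0 ≤ s → b i s = -∑ j, ∫ ξ in Ioo (0 : ℝ) 1,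
      partialResolvent (sourceKernel f g) (m + 1) i j s 1 ξ * y j s ξ) {s : ℝ} (hs : t0 ≤ s)
    (i : Fin m) {ξ : ℝ} (hξ : 0 ≤ ξ) :
    sourceTerm f g (zeroTrace t0 y) i s ξ = -∑ j, ∫ η in Ioo (0 : ℝ) 1,
      sourceKernel f g i j s ξ η * (y j s η - sourceTerm f g (zeroTrace t0 y) j s η) := by
  rw [h.ae_section_eq_kernel hg (fun j _ => h.ae_zeroTrace_eq_zero hg hb j) hs hξ]
  congr 1
  refine Finset.sum_congr rfl fun j _ => integral_congr_ae ?_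
  filter_upwards [h.ae_section_eq hg j hs] with η hη
  rw [hη]

/-- The initial value of `y - w` in terms of the initial value of `y`. -/
theorem ae_initial_eq_resolvent (h : IsMinusSolution f g t0 y0 b y)
    (hg : IsTriangularCoupling g)
    (hb : ∀ i s, t0 ≤ s → b i s = -∑ j, ∫ ξ in Ioo (0 : ℝ) 1,
      partialResolvent (sourceKernel f g) (m + 1) i j s 1 ξ * y j s ξ)
    (hy0 : ∀ j, Integrable (y0 j) (volume.restrict (Ioo (0 : ℝ) 1))) (i : Fin m) :
    ∀ᵐ ξ ∂volume.restrict (Ioo (0 : ℝ) 1),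
      sourceTerm f g (zeroTrace t0 y) i t0 ξ = -∑ j, ∫ η in Ioo (0 : ℝ) 1,
        partialResolvent (sourceKernel f g) m i j t0 ξ η * y0 j η := by
  obtain ⟨C, hC⟩ := hg.bounded
  have h1 := eq_add_resolvent (n := m) (v := fun j η => zeroTrace t0 y j ((f j).hit 0 t0 η))
    (measurable_sourceKernel f hg.continuous)
    (abs_sourceKernel_le f hC) (fun i j => sourceKernel_eq_zero f hg.triangular) hy0
    (s := t0) (fun l _ => by
      filter_upwards [h.ae_initial_eq hg l, ae_restrict_mem measurableSet_Ioo] with ξ h1 h2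
      rw [h1, h.ae_section_eq_kernel hg (fun j _ => h.ae_zeroTrace_eq_zero hg hb j) le_rfl h2.1.le,
        sub_neg_eq_add]) m i i.isLt i.isLt
  filter_upwards [h1, h.ae_initial_eq hg i] with ξ h2 h3
  rw [h3] at h2
  linarith

end IsMinusSolution

/-! ### Vector-valued functions -/

theorem tendsto_eLpNorm_sub_of_continuous {E : Type*} [NormedAddCommGroup E] {W : ℝ → ℝ → E}
    (hW : Continuous fun q : ℝ × ℝ => W q.1 q.2) {a b : ℝ} (t : ℝ) :
    Tendsto (fun s => eLpNorm (fun x => W s x - W t x) 2 (volume.restrict (Ioo a b))) (𝓝 t)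
      (𝓝 0) := by
  set M : ℝ≥0∞ := volume.restrict (Ioo a b) univ ^ (2 : ℝ≥0∞).toReal⁻¹
  have hM : M ≠ ∞ := by
    simp only [M, Measure.restrict_apply_univ, Real.volume_Ioo]
    exact ENNReal.rpow_ne_top_of_nonneg (by simp) ENNReal.ofReal_ne_top
  have h0 : Tendsto (fun ε : ℝ => M * ENNReal.ofReal ε) (𝓝[>] 0) (𝓝 0) := by
    have h1 : Tendsto (fun ε : ℝ => ENNReal.ofReal ε) (𝓝[>] 0) (𝓝 (ENNReal.ofReal 0)) :=
      (ENNReal.continuous_ofReal.tendsto 0).mono_left nhdsWithin_le_nhds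
    simpa using ENNReal.Tendsto.const_mul (a := M) h1 (Or.inr hM)
  rw [ENNReal.tendsto_nhds_zero]
  intro δ hδ
  obtain ⟨ε, hε1, hε2⟩ := (((ENNReal.tendsto_nhds_zero.1 h0) δ hδ).and self_mem_nhdsWithin).exists
  have h2 : ∀ᶠ s in 𝓝 t, ∀ x ∈ Icc a b, ‖W s x - W t x‖ < ε := by
    refine isCompact_Icc.eventually_forall_of_forall_eventually fun x _ => ?_
    have h3 : Continuous fun q : ℝ × ℝ => ‖W q.1 q.2 - W t q.2‖ :=
      (hW.sub (hW.comp (continuous_const.prodMk continuous_snd))).norm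
    refine (h3.tendsto (t, x)).eventually_lt_const ?_
    simpa using hε2
  filter_upwards [h2] with s hs
  refine (eLpNorm_le_of_ae_bound (C := ε) ?_).trans hε1
  filter_upwards [ae_restrict_mem measurableSet_Ioo] with x hx
  exact (hs x (Ioo_subset_Icc_self hx)).le

theorem memLp_of_continuous {E : Type*} [NormedAddCommGroup E] {W : ℝ → E}
    (hW : Continuous W) (a b : ℝ) : MemLp W 2 (volume.restrict (Ioo a b)) := by
  obtain ⟨C, hC⟩ := isCompact_Icc.exists_bound_of_continuousOn (s := Icc a b) hW.continuousOn
  have : IsFiniteMeasure (volume.restrict (Ioo a b)) := ⟨by simp⟩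
  refine MemLp.of_bound hW.aestronglyMeasurable C ?_
  filter_upwards [ae_restrict_mem measurableSet_Ioo] with x hx
  exact hC x (Ioo_subset_Icc_self hx)

theorem HasBroadRegularity.sub_continuous {m p : ℕ} {t0 : ℝ} {y W : ℝ → ℝ → HypState m p}
    (hy : HasBroadRegularity t0 y) (hW : Continuous fun q : ℝ × ℝ => W q.1 q.2) :
    HasBroadRegularity t0 fun t x => y t x - W t x := by
  have hWt : ∀ t, Continuous (W t) := fun t => hW.comp (continuous_const.prodMk continuous_id)
  have hWx : ∀ x, Continuous fun t => W t x := fun x =>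
    hW.comp (continuous_id.prodMk continuous_const)
  refine ⟨hy.measurable.sub hW.aestronglyMeasurable,
    fun t ht => (hy.memLp_space t ht).sub (memLp_of_continuous (hWt t) 0 1), fun t ht => ?_,
    fun T hT x hx => (hy.memLp_time T hT x hx).sub (memLp_of_continuous (hWx x) _ _),
    fun T hT x hx => ?_⟩
  · have h1 := (hy.continuous_time t ht).add
      ((tendsto_eLpNorm_sub_of_continuous hW (a := 0) (b := 1) t).mono_left
        (nhdsWithin_le_nhds (s := Ici t0)))
    rw [add_zero] at h1
    refine tendsto_of_tendsto_of_tendsto_of_le_of_le' tendsto_const_nhds h1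
      (Eventually.of_forall fun _ => zero_le) ?_
    filter_upwards [self_mem_nhdsWithin] with s hs
    refine le_trans (le_of_eq ?_) (eLpNorm_sub_le
      ((hy.memLp_space s hs).sub (hy.memLp_space t ht)).aestronglyMeasurable
      ((hWt s).sub (hWt t)).aestronglyMeasurable one_le_two)
    congr 1
    ext1 x
    simp only [Pi.sub_apply]
    abel
  · have hW' : Continuous fun q : ℝ × ℝ => (fun x t => W t x) q.1 q.2 := hW.comp continuous_swap
    have h1 := (hy.continuous_space T hT x hx).add
      ((tendsto_eLpNorm_sub_of_continuous (W := fun x t => W t x) hW' (a := t0) (b := t0 + T) x).mono_left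
        (nhdsWithin_le_nhds (s := Icc 0 1)))
    rw [add_zero] at h1
    refine tendsto_of_tendsto_of_tendsto_of_le_of_le' tendsto_const_nhds h1
      (Eventually.of_forall fun _ => zero_le) ?_
    filter_upwards [self_mem_nhdsWithin] with x' hx'
    refine le_trans (le_of_eq ?_) (eLpNorm_sub_le
      ((hy.memLp_time T hT x' hx').sub (hy.memLp_time T hT x hx)).aestronglyMeasurable
      ((hWx x').sub (hWx x)).aestronglyMeasurable one_le_two)
    congr 1
    ext1 t
    simp only [Pi.sub_apply]
    abel

theorem memLp_component {m p : ℕ} {z : ℝ → HypState m p} {μ : Measure ℝ} (hz : MemLp z 2 μ)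
    (j : Fin m ⊕ Fin p) : MemLp (fun x => z x j) 2 μ :=
  (EuclideanSpace.proj (𝕜 := ℝ) j).comp_memLp' hz

theorem eLpNorm_component_le {m p : ℕ} (z : ℝ → HypState m p) (μ : Measure ℝ)
    (j : Fin m ⊕ Fin p) : eLpNorm (fun x => z x j) 2 μ ≤ eLpNorm z 2 μ :=
  eLpNorm_mono fun x => PiLp.norm_apply_le (z x) j

/-- The embedding of `ℝᵐ` into the state space as the components with negative speeds. -/
noncomputable def minusState {m p : ℕ} (a : Fin m → ℝ) : HypState m p :=
  WithLp.toLp 2 (Sum.elim a 0)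

@[simp] theorem minusState_inl {m p : ℕ} (a : Fin m → ℝ) (i : Fin m) :
    (minusState a : HypState m p) (Sum.inl i) = a i := rfl

@[simp] theorem minusState_inr {m p : ℕ} (a : Fin m → ℝ) (k : Fin p) :
    (minusState a : HypState m p) (Sum.inr k) = 0 := rfl

theorem norm_minusState_le {m p : ℕ} (a : Fin m → ℝ) :
    ‖(minusState a : HypState m p)‖ ≤ ∑ i, |a i| := by
  rw [EuclideanSpace.norm_eq]
  refine Real.sqrt_le_iff.2 ⟨Finset.sum_nonneg fun _ _ => abs_nonneg _, ?_⟩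
  simp only [Fintype.sum_sum_type, minusState_inl, minusState_inr, Real.norm_eq_abs]
  simpa using Finset.sum_sq_le_sq_sum_of_nonneg (s := Finset.univ) (f := fun i => |a i|)
    fun _ _ => abs_nonneg _

/-- An integral operator with bounded kernel is bounded on `L²(0,1)`. -/
theorem eLpNorm_minusState_kernel_le {m p : ℕ} {κ : Fin m → Fin m → ℝ → ℝ → ℝ} {C : ℝ}
    (hC : ∀ i j ξ η, |κ i j ξ η| ≤ C) {z : ℝ → HypState m p}
    (hz : MemLp z 2 (volume.restrict (Ioo (0 : ℝ) 1))) {a : Fin m → ℝ → ℝ}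
    (ha : ∀ i, ∀ᵐ ξ ∂volume.restrict (Ioo (0 : ℝ) 1),
      a i ξ = -∑ j, ∫ η in Ioo (0 : ℝ) 1, κ i j ξ η * z η (Sum.inl j)) :
    eLpNorm (fun ξ => (minusState fun i => a i ξ : HypState m p)) 2
      (volume.restrict (Ioo (0 : ℝ) 1)) ≤
      ENNReal.ofReal (m * (m * C)) * eLpNorm z 2 (volume.restrict (Ioo (0 : ℝ) 1)) := by
  set μ := volume.restrict (Ioo (0 : ℝ) 1) with hμ
  -- Total mass one gives `L¹ ≤ L²` for `z` and turns the pointwise bound on `a` into an `L²` bound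
  -- without further constants.
  have hprob : IsProbabilityMeasure μ := ⟨by simp [hμ]⟩
  have hzi : Integrable z μ := hz.integrable (by norm_num)
  have hnorm : ENNReal.ofReal (∫ x, ‖z x‖ ∂μ) ≤ eLpNorm z 2 μ := by
    rw [ofReal_integral_norm_eq_lintegral_enorm hzi, ← eLpNorm_one_eq_lintegral_enorm]
    exact eLpNorm_le_eLpNorm_of_exponent_le (by norm_num) hz.aestronglyMeasurable
  have hbound : ∀ᵐ ξ ∂μ, ‖(minusState fun i => a i ξ : HypState m p)‖ ≤
      m * (m * C) * ∫ x, ‖z x‖ ∂μ := by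
    filter_upwards [ae_all_iff.2 ha] with ξ hξ
    refine (norm_minusState_le _).trans ?_
    have h1 : ∀ i ∈ (Finset.univ : Finset (Fin m)), |a i ξ| ≤ m * C * ∫ x, ‖z x‖ ∂μ := by
      intro i _
      rw [hξ i, abs_neg]
      refine (Finset.abs_sum_le_sum_abs _ _).trans ?_
      have h2 : ∀ j ∈ (Finset.univ : Finset (Fin m)),
          |∫ η, κ i j ξ η * z η (Sum.inl j) ∂μ| ≤ C * ∫ x, ‖z x‖ ∂μ := by
        intro j _
        rw [← integral_const_mul, ← Real.norm_eq_abs]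
        refine norm_integral_le_of_norm_le (hzi.norm.const_mul C) (Eventually.of_forall fun η => ?_)
        rw [norm_mul]
        exact mul_le_mul (hC _ _ _ _) (PiLp.norm_apply_le _ _) (norm_nonneg _)
          ((abs_nonneg _).trans (hC i j ξ η))
      refine (Finset.sum_le_sum h2).trans (le_of_eq ?_)
      simp [mul_assoc]
    refine (Finset.sum_le_sum h1).trans (le_of_eq ?_)
    simp [mul_assoc]
  refine (eLpNorm_le_of_ae_bound hbound).trans ?_
  -- For `m = 0` there is no kernel entry to force `0 ≤ C`.
  rcases Nat.eq_zero_or_pos m with hm | hm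
  · simp [hm]
  have hC0 : 0 ≤ C := (abs_nonneg _).trans (hC ⟨0, hm⟩ ⟨0, hm⟩ 0 0)
  rw [measure_univ, ENNReal.one_rpow, one_mul, ENNReal.ofReal_mul (by positivity)]
  exact mul_le_mul' le_rfl hnorm

/-! ### From broad solutions to transported components -/

/-- The coupling matrix extended from the strip to `ℝ × ℝ`. -/
noncomputable def clampCoupling {m : ℕ} (G : ℝ → ℝ → Matrix (Fin m) (Fin m) ℝ) (i j : Fin m) :
    ℝ → ℝ → ℝ :=
  clampStrip fun t x => G t x i j

theorem isTriangularCoupling_clampCoupling {m : ℕ} {G : ℝ → ℝ → Matrix (Fin m) (Fin m) ℝ}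
    (hG : IsBoundedContinuousMatrix G)
    (htri : ∀ t x : ℝ, 0 ≤ t → x ∈ Icc (0 : ℝ) 1 → ∀ i j : Fin m, i ≤ j → G t x i j = 0) :
    IsTriangularCoupling (clampCoupling G) := by
  refine ⟨fun i j => continuous_clampStrip (hG i j).1, ?_,
    fun i j hij t x => htri _ _ (le_max_right _ _) (clamp_mem x) i j hij⟩
  choose C hC using fun i j => (hG i j).2
  refine ⟨∑ i, ∑ j, |C i j|, fun i j t x => ?_⟩
  refine (hC i j _ _ (le_max_right t 0) (clamp_mem x)).trans ((le_abs_self _).trans ?_)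
  exact (Finset.single_le_sum (f := fun j => |C i j|) (fun _ _ => abs_nonneg _)
    (Finset.mem_univ j)).trans (Finset.single_le_sum (f := fun i => ∑ j, |C i j|)
      (fun _ _ => Finset.sum_nonneg fun _ _ => abs_nonneg _) (Finset.mem_univ i))

section Characteristics

variable {m p : ℕ} {lam : ℝ → ℝ → Fin m ⊕ Fin p → ℝ} {f : Fin m → NegativeFlow}

/-- The broad equation speaks about all backward characteristics, so one has to be exhibited before
it yields anything. -/
theorem isBackwardCharacteristic_flow {i : Fin m}
    (hf : (f i).speed = clampStrip fun t x => lam t x (Sum.inl i)) {t0 t x : ℝ}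
    (ht0 : 0 ≤ t0) (ht : t0 < t) (hx : x ∈ Ioo (0 : ℝ) 1) :
    IsBackwardCharacteristic (fun s z => lam s z (Sum.inl i))
      (entryPoint (Sum.inl i : Fin m ⊕ Fin p)) t0 t x
      (max t0 ((f i).hit 1 t x)) fun s => (f i).flow s t x := by
  have hin : ∀ s ∈ Icc (max t0 ((f i).hit 1 t x)) t, (f i).flow s t x ∈ Icc (0 : ℝ) 1 := by
    intro s hs
    constructor
    · rw [← (f i).le_hit_iff]
      exact hs.2.trans ((f i).lt_hit_zero hx.1).le
    · rw [← (f i).hit_le_iff]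
      exact (le_max_right _ _).trans hs.1
  refine ⟨⟨le_max_left _ _, max_le ht.le ((f i).hit_one_lt hx.2).le⟩, hin, fun s hs => ?_,
    (f i).flow_self t x, ?_⟩
  · have h1 := ((f i).hasDerivAt_flow s t x).hasDerivWithinAt
      (s := Icc (max t0 ((f i).hit 1 t x)) t)
    rwa [hf, clampStrip_eq _ (ht0.trans ((le_max_left _ _).trans hs.1)) (hin s hs)] at h1
  · rcases le_total ((f i).hit 1 t x) t0 with h | h
    · exact Or.inl (max_eq_left h)
    · right
      simp only [max_eq_right h, NegativeFlow.flow_hit, entryPoint]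

/-- Uniqueness for the ODE. The broad equation of the transformed solution must be checked on an
arbitrary characteristic, which is hereby a flow line. -/
theorem IsBackwardCharacteristic.eq_flow {i : Fin m}
    (hf : (f i).speed = clampStrip fun t x => lam t x (Sum.inl i)) {e t0 t x s0 : ℝ}
    {c : ℝ → ℝ} (ht0 : 0 ≤ t0)
    (hc : IsBackwardCharacteristic (fun s z => lam s z (Sum.inl i)) e t0 t x s0 c) :
    ∀ s ∈ Icc s0 t, c s = (f i).flow s t x := by
  refine (f i).eq_flow ⟨hc.time_mem.2, le_rfl⟩ (fun s hs => ?_) hc.final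
  have h1 := hc.ode s hs
  rwa [hf, clampStrip_eq _ (ht0.trans (hc.time_mem.1.trans hs.1)) (hc.inside s hs)]

theorem sum_integral_blocks {i : Fin m}
    (hf : (f i).speed = clampStrip fun t x => lam t x (Sum.inl i)) {e t0 t x s0 : ℝ}
    {c : ℝ → ℝ} (ht0 : 0 ≤ t0)
    (hc : IsBackwardCharacteristic (fun s z => lam s z (Sum.inl i)) e t0 t x s0 c)
    {G : ℝ → ℝ → Matrix (Fin m) (Fin m) ℝ} (hG : IsTriangularCoupling (clampCoupling G))
    (H : ℝ → ℝ → Matrix (Fin p) (Fin m) ℝ) {y : ℝ → ℝ → HypState m p}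
    (hu : ∀ j, LocallyIntegrable (zeroTrace t0 (fun j t x => y t x (Sum.inl j)) j)) :
    (∑ j, ∫ s in s0..t, Matrix.fromBlocks (G s (c s)) 0 (H s (c s)) 0 (Sum.inl i) j * y s 0 j) =
      ∫ r in s0..t, ∑ j, clampCoupling G i j r ((f i).flow r t x) *
        zeroTrace t0 (fun j t x => y t x (Sum.inl j)) j r := by
  have hint : ∀ j, IntervalIntegrable (fun r => clampCoupling G i j r ((f i).flow r t x) *
      zeroTrace t0 (fun j t x => y t x (Sum.inl j)) j r) volume s0 t := fun j =>
    intervalIntegrable_continuous_mul ((hG.continuous i j).comp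
        (continuous_id.prodMk ((f i).differentiable_flow t x).continuous)) (hu j) _ _
  rw [intervalIntegral.integral_finsetSum fun j _ => hint j, Fintype.sum_sum_type]
  simp only [Matrix.fromBlocks_apply₁₁, Matrix.fromBlocks_apply₁₂, Matrix.zero_apply, zero_mul,
    intervalIntegral.integral_zero, Finset.sum_const_zero, add_zero]
  refine Finset.sum_congr rfl fun j _ => ?_
  rw [intervalIntegral.integral_of_le hc.time_mem.2, intervalIntegral.integral_of_le hc.time_mem.2]
  -- On `(s0, t]` the time exceeds `t0` and the characteristic lies in `[0,1]`, so neither the zero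
  -- extension of the trace nor the clamping of the coupling is visible.
  refine setIntegral_congr_fun measurableSet_Ioc fun s hs => ?_
  have h1 := hc.eq_flow hf ht0 s (Ioc_subset_Icc_self hs)
  have h2 : s ∈ Ioi t0 := hc.time_mem.1.trans_lt hs.1
  simp only [zeroTrace, indicator_of_mem h2, clampCoupling, ← h1]
  rw [clampStrip_eq _ (ht0.trans (le_of_lt h2)) (hc.inside s (Ioc_subset_Icc_self hs))]

theorem HasBroadRegularity.locallyIntegrable_zeroTrace {t0 : ℝ} {y : ℝ → ℝ → HypState m p}
    (hy : HasBroadRegularity t0 y) (j : Fin m) :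
    LocallyIntegrable (zeroTrace t0 (fun j t x => y t x (Sum.inl j)) j) :=
  locallyIntegrable_indicator_of_memLp (fun T hT =>
    memLp_component (hy.memLp_time T hT 0 ⟨le_rfl, zero_le_one⟩) (Sum.inl j))

theorem IsBroadSolution.isMinusSolution
    (hf : ∀ i, (f i).speed = clampStrip fun t x => lam t x (Sum.inl i))
    {G : ℝ → ℝ → Matrix (Fin m) (Fin m) ℝ} (hG : IsTriangularCoupling (clampCoupling G))
    {H : ℝ → ℝ → Matrix (Fin p) (Fin m) ℝ} {F : ℝ → ℝ → Matrix (Fin m) (Fin m ⊕ Fin p) ℝ}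
    {Q : ℝ → Matrix (Fin p) (Fin m) ℝ} {t0 : ℝ} (ht0 : 0 ≤ t0) {y0 : ℝ → HypState m p}
    {y : ℝ → ℝ → HypState m p}
    (hy : IsBroadSolution lam 0 (fun t x => Matrix.fromBlocks (G t x) 0 (H t x) 0) F Q t0 y0 y) :
    IsMinusSolution f (clampCoupling G) t0 (fun i x => y0 x (Sum.inl i))
      (fun i s => boundaryValue F Q y s (Sum.inl i)) (fun i t x => y t x (Sum.inl i)) := by
  have hr := hy.regularity
  refine ⟨fun i t ht => memLp_component (hr.memLp_space t ht) _, fun i t ht => ?_,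
    fun i T hT x hx => memLp_component (hr.memLp_time T hT x hx) _, fun i T hT => ?_, ?_⟩
  · refine tendsto_of_tendsto_of_tendsto_of_le_of_le tendsto_const_nhds (hr.continuous_time t ht)
      (fun _ => zero_le) fun s => ?_
    exact eLpNorm_component_le (fun x => y s x - y t x) _ (Sum.inl i)
  · refine tendsto_of_tendsto_of_tendsto_of_le_of_le tendsto_const_nhds
      (hr.continuous_space T hT 0 ⟨le_rfl, zero_le_one⟩) (fun _ => zero_le) fun x => ?_
    exact eLpNorm_component_le (fun t => y t x - y t 0) _ (Sum.inl i)
  · filter_upwards [hy.equation, ae_restrict_mem (measurableSet_Ioi.prod measurableSet_Ioo)]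
      with q hq hmem i
    have hc := isBackwardCharacteristic_flow (p := p) (hf i) ht0 hmem.1 hmem.2
    have h1 := hq (Sum.inl i) _ _ hc
    rw [sum_integral_blocks (hf i) ht0 hc hG H hr.locallyIntegrable_zeroTrace] at h1
    rw [h1]
    simp only [lt_max_iff, lt_self_iff_false, false_or, Pi.zero_apply, Matrix.zero_apply, zero_mul,
      intervalIntegral.integral_zero, Finset.sum_const_zero, add_zero]
    congr 1
    split_ifs with h
    · rw [max_eq_right h.le]
    · rfl

end Characteristics

/-! ### The feedback and the transformed solution -/

/-- The feedback kernel acting on the components with negative speeds. -/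
noncomputable def feedbackKernel {m p : ℕ} (f : Fin m → NegativeFlow)
    (g : Fin m → Fin m → ℝ → ℝ → ℝ) (s ζ : ℝ) : Matrix (Fin m) (Fin m ⊕ Fin p) ℝ :=
  Matrix.of fun i => Sum.elim
    -- With `z = y + R_m y`, the required boundary value is `-(K z)(1) = -(K y + K R_m y)(1)`, which
    -- is minus the sum of length `m + 1` at position `1`.
    (fun j => -partialResolvent (sourceKernel f g) (m + 1) i j s 1 ζ) 0

theorem isLInftyMatrix_feedbackKernel {m p : ℕ} (f : Fin m → NegativeFlow)
    {g : Fin m → Fin m → ℝ → ℝ → ℝ} (hg : IsTriangularCoupling g) :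
    IsLInftyMatrix (feedbackKernel f g : ℝ → ℝ → Matrix (Fin m) (Fin m ⊕ Fin p) ℝ) := by
  obtain ⟨C, hC⟩ := hg.bounded
  obtain ⟨D, hD0, hD⟩ := exists_bound_partialResolvent (abs_sourceKernel_le f hC) (m + 1)
  rintro i (j | k)
  · refine memLp_top_of_bound (C := D) (Measurable.aestronglyMeasurable ?_)
      (Eventually.of_forall fun q => ?_)
    · exact ((measurable_partialResolvent (measurable_sourceKernel f hg.continuous) (m + 1) i j).comp
        (f := fun q : ℝ × ℝ => (q.1, 1, q.2)) (by fun_prop)).neg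
    · simpa [feedbackKernel] using hD i j q.1 1 q.2
  · simp [feedbackKernel]

theorem boundaryValue_feedbackKernel {m p : ℕ} (f : Fin m → NegativeFlow)
    (g : Fin m → Fin m → ℝ → ℝ → ℝ) (Q : ℝ → Matrix (Fin p) (Fin m) ℝ)
    (y : ℝ → ℝ → HypState m p) (s : ℝ) (i : Fin m) :
    boundaryValue (feedbackKernel f g) Q y s (Sum.inl i) = -∑ j, ∫ ξ in Ioo (0 : ℝ) 1,
      partialResolvent (sourceKernel f g) (m + 1) i j s 1 ξ * y s ξ (Sum.inl j) := by
  simp only [boundaryValue, feedbackKernel, Fintype.sum_sum_type, Matrix.of_apply, Sum.elim_inl,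
    Sum.elim_inr, Pi.zero_apply, zero_mul, integral_zero, Finset.sum_const_zero,
    add_zero, neg_mul, integral_neg, Finset.sum_neg_distrib,
    intervalIntegral.integral_of_le zero_le_one, integral_Ioc_eq_integral_Ioo]

theorem boundaryValue_zero_inl {m p : ℕ} (Q : ℝ → Matrix (Fin p) (Fin m) ℝ)
    (y : ℝ → ℝ → HypState m p) (s : ℝ) (i : Fin m) :
    boundaryValue 0 Q y s (Sum.inl i) = 0 := by
  simp [boundaryValue]

section Transform

variable {m p : ℕ} {lam : ℝ → ℝ → Fin m ⊕ Fin p → ℝ} {f : Fin m → NegativeFlow}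
  {G : ℝ → ℝ → Matrix (Fin m) (Fin m) ℝ} {H : ℝ → ℝ → Matrix (Fin p) (Fin m) ℝ}
  {Q : ℝ → Matrix (Fin p) (Fin m) ℝ} {t0 : ℝ} {y0 : ℝ → HypState m p} {y : ℝ → ℝ → HypState m p}

/-- The part of the solution generated by the coupling with the trace at `x = 0`. -/
noncomputable def sourceState (f : Fin m → NegativeFlow) (G : ℝ → ℝ → Matrix (Fin m) (Fin m) ℝ)
    (t0 : ℝ) (y : ℝ → ℝ → HypState m p) (t x : ℝ) : HypState m p :=
  minusState fun i =>
    sourceTerm f (clampCoupling G) (zeroTrace t0 fun j t x => y t x (Sum.inl j)) i t x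

theorem continuous_minusState {X : Type*} [TopologicalSpace X] {a : X → Fin m → ℝ}
    (ha : ∀ i, Continuous fun q => a q i) : Continuous fun q => (minusState (a q) : HypState m p) := by
  refine (PiLp.continuous_toLp 2 _).comp (continuous_pi ?_)
  rintro (i | k)
  · exact ha i
  · exact continuous_const

/-- The source term solves the same forced transport equation as the negative components, and the
feedback gives both the same value at `x = 1`. Their difference is therefore unforced with zero
inflow, and the trace at `x = 0` that drives the positive components is unchanged. -/
theorem IsBroadSolution.sub_sourceState
    (hf : ∀ i, (f i).speed = clampStrip fun t x => lam t x (Sum.inl i))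
    (hG : IsTriangularCoupling (clampCoupling G)) (ht0 : 0 ≤ t0)
    (hy : IsBroadSolution lam 0 (fun t x => Matrix.fromBlocks (G t x) 0 (H t x) 0)
      (feedbackKernel f (clampCoupling G)) Q t0 y0 y) :
    IsBroadSolution lam 0 (fun t x => Matrix.fromBlocks 0 0 (H t x) 0) 0 Q t0
      (fun x => y0 x - sourceState f G t0 y t0 x) (fun t x => y t x - sourceState f G t0 y t x) := by
  have hmin := hy.isMinusSolution hf hG ht0
  have hb := fun i s (_ : t0 ≤ s) =>
    boundaryValue_feedbackKernel f (clampCoupling G) Q y s i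
  have hcont : Continuous fun q : ℝ × ℝ => sourceState f G t0 y q.1 q.2 :=
    continuous_minusState fun i => hmin.continuous_source hG i
  refine ⟨hy.regularity.sub_continuous hcont, ?_⟩
  filter_upwards [hy.equation] with q hq
  have htrace : ∀ s (j : Fin m), (y s 0 - sourceState f G t0 y s 0) (Sum.inl j) =
      y s 0 (Sum.inl j) := by
    intro s j
    simp [sourceState, sourceTerm_zero]
  rintro (i | k) s0 c hc
  · have hu := hy.regularity.locallyIntegrable_zeroTrace
    have h1 := hq (Sum.inl i) s0 c hc
    rw [sum_integral_blocks (hf i) ht0 hc hG H hu] at h1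
    simp only [Pi.zero_apply, Matrix.zero_apply, zero_mul,
      intervalIntegral.integral_zero, Finset.sum_const_zero, add_zero] at h1
    set S := sourceTerm f (clampCoupling G) (zeroTrace t0 fun j t x => y t x (Sum.inl j)) i
      with hS
    -- Along the characteristic `S` accumulates exactly the source term of the equation for `y`, so
    -- the integrals cancel in `y - S`.
    have h2 : S s0 (c s0) = S q.1 q.2 - ∫ r in s0..q.1, ∑ j, clampCoupling G i j r
        ((f i).flow r q.1 q.2) * zeroTrace t0 (fun j t x => y t x (Sum.inl j)) j r := by
      have hint := intervalIntegrable_source f hG.continuous hu i q.1 q.2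
      rw [hc.eq_flow (hf i) ht0 s0 ⟨le_rfl, hc.time_mem.2⟩, hS, sourceTerm_flow, sourceTerm,
        ← intervalIntegral.integral_add_adjacent_intervals (hint s0 q.1) (hint q.1 _)]
      ring
    have h3 : (y q.1 q.2 - sourceState f G t0 y q.1 q.2) (Sum.inl i) =
        y q.1 q.2 (Sum.inl i) - S q.1 q.2 := rfl
    rw [h3, h1]
    simp only [Matrix.fromBlocks, Matrix.of_apply, Sum.elim_inl, Fintype.sum_sum_type,
      Sum.elim_inr, Pi.zero_apply, Matrix.zero_apply, zero_mul, intervalIntegral.integral_zero,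
      Finset.sum_const_zero, add_zero, boundaryValue_zero_inl]
    split_ifs with h
    -- Entry after `t0`, hence at `x = 1`, where the feedback makes `y` equal to `S`.
    · have h4 := hmin.boundary_eq_sourceTerm hG hb
        (fun j _ => hmin.ae_zeroTrace_eq_zero hG hb j) (i := i) h.le
      have h5 : c s0 = 1 := by
        rcases hc.start with h6 | h6
        · exact absurd h6 h.ne'
        · exact h6
      rw [h5] at h2
      rw [h4]
      linarith
    · have h5 : s0 = t0 := le_antisymm (not_lt.1 h) hc.time_mem.1
      have h6 : (y0 (c t0) - sourceState f G t0 y t0 (c t0)) (Sum.inl i) =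
        y0 (c t0) (Sum.inl i) - S t0 (c t0) := rfl
      rw [h6]
      rw [h5] at h2 ⊢
      linarith
  -- The positive rows see `y` only through its negative trace at `x = 0`, which `htrace` preserves;
  -- their equation carries over for the same characteristic.
  · have h1 := hq (Sum.inr k) s0 c hc
    have h3 : ∀ (z : HypState m p) (w : Fin m → ℝ), (z - minusState w : HypState m p) (Sum.inr k) = z (Sum.inr k) := by
      intro z w
      simp
    rw [sourceState, h3, h1, sourceState, h3]
    simp only [Pi.zero_apply, Matrix.zero_apply, zero_mul, Fintype.sum_sum_type,
      Matrix.fromBlocks_apply₂₁, Matrix.fromBlocks_apply₂₂, boundaryValue, htrace]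

/-- At every time the removed term is `-K` applied to the new state, and initially it is `-R_m`
applied to `y0`. Both kernels are bounded uniformly in time, so a single constant serves all initial
times and data. -/
theorem exists_transform_bounds (f : Fin m → NegativeFlow)
    (hf : ∀ i, (f i).speed = clampStrip fun t x => lam t x (Sum.inl i))
    (hG : IsTriangularCoupling (clampCoupling G)) (H : ℝ → ℝ → Matrix (Fin p) (Fin m) ℝ)
    (Q : ℝ → Matrix (Fin p) (Fin m) ℝ) :
    ∃ D : ℝ, 0 ≤ D ∧ ∀ t0 : ℝ, 0 ≤ t0 → ∀ y0 : ℝ → HypState m p,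
      MemLp y0 2 (volume.restrict (Ioo (0 : ℝ) 1)) → ∀ y,
      IsBroadSolution lam 0 (fun t x => Matrix.fromBlocks (G t x) 0 (H t x) 0)
        (feedbackKernel f (clampCoupling G)) Q t0 y0 y → ∃ z0 z,
      MemLp z0 2 (volume.restrict (Ioo (0 : ℝ) 1)) ∧
      IsBroadSolution lam 0 (fun t x => Matrix.fromBlocks 0 0 (H t x) 0) 0 Q t0 z0 z ∧
      eLpNorm z0 2 (volume.restrict (Ioo (0 : ℝ) 1)) ≤
        ENNReal.ofReal (1 + D) * eLpNorm y0 2 (volume.restrict (Ioo (0 : ℝ) 1)) ∧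
      ∀ t, t0 ≤ t → eLpNorm (y t) 2 (volume.restrict (Ioo (0 : ℝ) 1)) ≤
        ENNReal.ofReal (1 + D) * eLpNorm (z t) 2 (volume.restrict (Ioo (0 : ℝ) 1)) := by
  obtain ⟨C, hC⟩ := hG.bounded
  have hκ := abs_sourceKernel_le f hC
  obtain ⟨D1, hD10, hD1⟩ := exists_bound_partialResolvent hκ m
  set D2 := max (C * ∑ k, (f k).hitLip) D1
  have hD2 : 0 ≤ D2 := hD10.trans (le_max_right _ _)
  refine ⟨m * (m * D2), by positivity, fun t0 ht0 y0 hy0 y hy => ?_⟩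
  have hmin := hy.isMinusSolution hf hG ht0
  have hb := fun i s (_ : t0 ≤ s) =>
    boundaryValue_feedbackKernel f (clampCoupling G) Q y s i
  have hz := hy.sub_sourceState hf hG ht0
  have hcont : Continuous fun q : ℝ × ℝ => sourceState f G t0 y q.1 q.2 :=
    continuous_minusState fun i => hmin.continuous_source hG i
  have hcont' : ∀ t, Continuous (sourceState f G t0 y t) := fun t =>
    hcont.comp (continuous_const.prodMk continuous_id)
  have hD : ENNReal.ofReal (1 + m * (m * D2)) = 1 + ENNReal.ofReal (m * (m * D2)) := by
    rw [ENNReal.ofReal_add zero_le_one (by positivity), ENNReal.ofReal_one]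
  refine ⟨_, _, hy0.sub (memLp_of_continuous (hcont' t0) 0 1), hz, ?_, fun t ht => ?_⟩
  · refine (eLpNorm_sub_le hy0.aestronglyMeasurable (hcont' t0).aestronglyMeasurable
      one_le_two).trans ?_
    rw [hD, add_mul, one_mul]
    refine add_le_add le_rfl ?_
    refine eLpNorm_minusState_kernel_le
      (κ := fun i j => partialResolvent (sourceKernel f (clampCoupling G)) m i j t0)
      (fun i j ξ η => (hD1 i j t0 ξ η).trans (le_max_right _ _)) hy0
      (hmin.ae_initial_eq_resolvent hG hb fun j =>
        (memLp_component hy0 (Sum.inl j)).integrable (by norm_num))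
  · have hzt := hz.regularity.memLp_space t ht
    have h1 : y t = (fun x => y t x - sourceState f G t0 y t x) + sourceState f G t0 y t := by
      ext1 x
      simp
    conv_lhs => rw [h1]
    refine (eLpNorm_add_le hzt.aestronglyMeasurable (hcont' t).aestronglyMeasurable
      one_le_two).trans ?_
    rw [hD, add_mul, one_mul]
    refine add_le_add le_rfl ?_
    refine eLpNorm_minusState_kernel_le
      (κ := fun i j => sourceKernel f (clampCoupling G) i j t)
      (fun i j ξ η => (hκ i j t ξ η).trans (le_max_left _ _)) hzt fun i => ?_
    filter_upwards [ae_restrict_mem measurableSet_Ioo] with ξ hξ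
    exact hmin.sourceTerm_eq_neg_kernel hG hb ht i hξ.1.le

end Transform

/-! ### Transfer of finite-time stability -/

theorem proposition2p4 (m p : ℕ) (hm : 1 ≤ m) (hp : 1 ≤ p)
    (lam : ℝ → ℝ → Fin m ⊕ Fin p → ℝ) (hlam : AdmissibleSpeeds lam)
    (Q1 : ℝ → Matrix (Fin p) (Fin m) ℝ) (hQ1 : IsBoundedContinuousMatrixTime Q1)
    (G2mm : ℝ → ℝ → Matrix (Fin m) (Fin m) ℝ) (hG2mm : IsBoundedContinuousMatrix G2mm)
    (hG2tri : ∀ t x : ℝ, 0 ≤ t → x ∈ Set.Icc (0 : ℝ) 1 →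
      ∀ i j : Fin m, i ≤ j → G2mm t x i j = 0)
    (G2pm : ℝ → ℝ → Matrix (Fin p) (Fin m) ℝ) (hG2pm : IsBoundedContinuousMatrix G2pm) :
    ∃ F2 : ℝ → ℝ → Matrix (Fin m) (Fin m ⊕ Fin p) ℝ, IsLInftyMatrix F2 ∧
      ∀ T : ℝ, 0 < T →
        FiniteTimeStable lam 0 (fun t x => Matrix.fromBlocks 0 0 (G2pm t x) 0) 0 Q1 T →
        FiniteTimeStable lam 0 (fun t x => Matrix.fromBlocks (G2mm t x) 0 (G2pm t x) 0) F2 Q1 T := by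
  choose f hf using hlam.exists_flow
  have hG := isTriangularCoupling_clampCoupling hG2mm hG2tri
  refine ⟨feedbackKernel f (clampCoupling G2mm), isLInftyMatrix_feedbackKernel f hG, ?_⟩
  rintro T hT ⟨hattr, hstab⟩
  obtain ⟨D, hD0, hD⟩ := exists_transform_bounds f hf hG G2pm Q1
  refine ⟨fun t0 ht0 y0 hy0 y hy => ?_, fun ε hε => ?_⟩
  · obtain ⟨z0, z, hz0, hz, -, hbound⟩ := hD t0 ht0 y0 hy0 y hy
    have h1 := hattr t0 ht0 z0 hz0 z hz
    have h2 := hbound (t0 + T) (by linarith)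
    rw [eLpNorm_congr_ae h1, eLpNorm_zero, mul_zero] at h2
    exact (eLpNorm_eq_zero_iff
      (hy.regularity.memLp_space (t0 + T) (by linarith)).aestronglyMeasurable (by norm_num)).1
      (nonpos_iff_eq_zero.1 h2)
  · have hpos : 0 < 1 + D := by linarith
    -- The factor `1 + D` is lost twice: from `y0` to `z0`, which shrinks `δ`, and from `z` back to
    -- `y`, which shrinks `ε`.
    obtain ⟨δ, hδ, hstab⟩ := hstab (ε / (1 + D)) (by positivity)
    refine ⟨δ / (1 + D), by positivity, fun t0 ht0 y0 hy0 hle y hy t ht => ?_⟩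
    obtain ⟨z0, z, hz0, hz, hz0le, hbound⟩ := hD t0 ht0 y0 hy0 y hy
    have hmul : ∀ r : ℝ, ENNReal.ofReal (1 + D) * ENNReal.ofReal (r / (1 + D)) =
        ENNReal.ofReal r := by
      intro r
      rw [← ENNReal.ofReal_mul hpos.le, mul_div_cancel₀ _ hpos.ne']
    have h1 : eLpNorm z0 2 (volume.restrict (Ioo (0 : ℝ) 1)) ≤ ENNReal.ofReal δ := by
      refine hz0le.trans ?_
      rw [← hmul δ]
      exact mul_le_mul' le_rfl hle
    refine (hbound t ht).trans ?_
    rw [← hmul ε]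
    exact mul_le_mul' le_rfl (hstab t0 ht0 z0 hz0 h1 z hz t ht)
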